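/- Let $H$ be a finite-dimensional complex Hilbert space. A quantum channel is a completely positive trace-preserving linear map. For a linear map $\Phi$ on $B(H)$, let $\Phi^*$ be its Hilbert–Schmidt adjoint, $\Phi^t$ its $t$-fold composition, and $\Phi^{\otimes n}$ its $n$-fold tensor power. For a state $\sigma$ of full rank, the channel $\Phi$ is GNS-symmetric with respect to $\sigma$ if $\operatorname{tr}(X\,\Phi^*(Y)\,\sigma)=\operatorname{tr}(\Phi^*(X)\,Y\,\sigma)$ for all $X,Y\in B(H)$. Capacities. For a channel $\Phi$ on $B(H)$, let $C_0(\Phi)$ (respectively $Q_0(\Phi)$) be the supremum of $\log d$ over all $d\ge 1$ for which there are channels $\mathcal E:M_d\to B(H)$ and $\mathcal D:B(H)\to M_d$ such that $T=\mathcal D\circ\Phi\circ\mathcal E$ satisfies $\frac1d\sum_{i=1}^d\langle i|T(|i\rangle\langle i|)|i\rangle\ge 1$ (respectively $\langle\phi|(\mathrm{id}\otimes T)(|\phi\rangle\langle\phi|)|\phi\rangle\ge 1$, where $|\phi\rangle=\frac1{\sqrt d}\sum_{i}|i\rangle\otimes|i\rangle$). Constants. For a linear map $P$ on $B(H)$ put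 $\Lambda(P)=\inf\{C>0: X\le C\,P(X)\text{ for all }X\ge 0\}$ and $\Lambda_c(P)=\sup_{k}\Lambda(\mathrm{id}_{M_k}\otimes P)$. Define $\lambda=\lambda_\sigma(\Phi,P)\in(-\infty,+\infty]$ by $e^{-\lambda}=\|\Phi^*\circ(\mathrm{id}-P^*)\|$, the operator norm being taken on $L_2(\sigma)$, i.e. on $B(H)$ with inner product $\langle X,Y\rangle_\sigma=\operatorname{tr}(X^\dagger Y\sigma)$; here $\lambda=+\infty$, and quotients by $\lambda$ are $0$, if this norm is $0$. Theorem. Let $\Phi$ be a channel on $B(H)$ that is GNS-symmetric with respect to a full-rank state $\sigma$. Then the limit $P=\lim_{t\to\infty}\Phi^{2t}$ exists and is a channel, and, with $\lambda=\lambda_\sigma(\Phi,P)$, $$C_0(\Phi^t)=C_0(P)\quad\text{and}\quad Q_0(\Phi^t)=Q_0(P)\qquad\text{for all } t\in\mathbb N \text{ with } t>\frac{\ln(10\,\Lambda_c(P))}{\lambda}.$$ Moreover, for tensor powers the threshold grows only linearly: for every $n\ge 1$ one has $\lim_{t\to\infty}(\Phi^{\otimes n})^{2t}=P^{\otimes n}$,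 $\lambda_{\sigma^{\otimes n}}(\Phi^{\otimes n},P^{\otimes n})=\lambda$, $\Lambda_c(P^{\otimes n})=\Lambda_c(P)^n$, and $$C_0\big((\Phi^{\otimes n})^t\big)=C_0(P^{\otimes n})\quad\text{and}\quad Q_0\big((\Phi^{\otimes n})^t\big)=Q_0(P^{\otimes n})\qquad\text{for all } t\in\mathbb N \text{ with } t>\frac{n\ln\Lambda_c(P)+\ln 10}{\lambda}.$$ -/

import Mathlib

open scoped Matrix NNReal ENNReal ComplexOrder
open Filter Topology

namespace QuantumCapacity

noncomputable section

/-- The ampliation `id_{M_k} ⊗ Φ`: the map `Φ` is applied to every block of a block matrix. -/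
def ampliation (k : ℕ) {m n : Type*} (Φ : Matrix m m ℂ →ₗ[ℂ] Matrix n n ℂ) :
    Matrix (Fin k × m) (Fin k × m) ℂ →ₗ[ℂ] Matrix (Fin k × n) (Fin k × n) ℂ where
  toFun X := Matrix.of fun p q => Φ (Matrix.of fun i j => X (p.1, i) (q.1, j)) p.2 q.2
  map_add' X Y := by
    ext p q
    exact congrFun (congrFun (Φ.map_add (Matrix.of fun i j => X (p.1, i) (q.1, j))
      (Matrix.of fun i j => Y (p.1, i) (q.1, j))) p.2) q.2
  map_smul' c X := by
    ext p q
    exact congrFun (congrFun (Φ.map_smul c (Matrix.of fun i j => X (p.1, i) (q.1, j))) p.2) q.2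

/-- A quantum channel: a completely positive and trace preserving linear map. -/
structure IsChannel {m n : Type*} [Fintype m] [Fintype n]
    (Φ : Matrix m m ℂ →ₗ[ℂ] Matrix n n ℂ) : Prop where
  completelyPositive : ∀ (k : ℕ) (X : Matrix (Fin k × m) (Fin k × m) ℂ),
    X.PosSemidef → (ampliation k Φ X).PosSemidef
  tracePreserving : ∀ X : Matrix m m ℂ, (Φ X).trace = X.trace

/-- The adjoint `Φ^*` for the Hilbert-Schmidt inner product `⟨X, Y⟩ = tr (Xᴴ Y)`; its `(i, j)`
entry is `⟨E_ij, Φ^* Y⟩ = ⟨Φ E_ij, Y⟩`, where `E_ij` is the matrix unit. -/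
def hsAdjoint {m : Type*} [Fintype m] [DecidableEq m] (Φ : Module.End ℂ (Matrix m m ℂ)) :
    Module.End ℂ (Matrix m m ℂ) where
  toFun Y := Matrix.of fun i j => ((Φ (Matrix.single i j 1))ᴴ * Y).trace
  map_add' X Y := by
    ext i j
    simp [Matrix.mul_add]
  map_smul' c X := by
    ext i j
    simp

theorem trace_conjTranspose_mul_hsAdjoint {m : Type*} [Fintype m] [DecidableEq m]
    (Φ : Module.End ℂ (Matrix m m ℂ)) (X Y : Matrix m m ℂ) :
    (Xᴴ * hsAdjoint Φ Y).trace = ((Φ X)ᴴ * Y).trace := by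
  have hX : X = ∑ i, ∑ j, X i j • Matrix.single i j (1 : ℂ) := by
    conv_lhs => rw [Matrix.matrix_eq_sum_single X]
    simp [Matrix.smul_single]
  have hR : ((Φ X)ᴴ * Y).trace =
      ∑ i, ∑ j, star (X i j) * ((Φ (Matrix.single i j 1))ᴴ * Y).trace := by
    conv_lhs => rw [hX]
    simp only [map_sum, map_smul, Matrix.conjTranspose_sum, Matrix.conjTranspose_smul,
      Finset.sum_mul, Matrix.trace_sum, Matrix.smul_mul, Matrix.trace_smul, smul_eq_mul]
  rw [hR, Matrix.trace, Finset.sum_comm]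
  simp [Matrix.mul_apply, hsAdjoint]

/-- GNS-symmetry with respect to `σ`. -/
def IsGNSSymmetric {m : Type*} [Fintype m] [DecidableEq m]
    (Φ : Module.End ℂ (Matrix m m ℂ)) (σ : Matrix m m ℂ) : Prop :=
  ∀ X Y : Matrix m m ℂ, (X * hsAdjoint Φ Y * σ).trace = (hsAdjoint Φ X * Y * σ).trace

/-- The norm of `L_2(σ)`, given by the GNS inner product `⟨X, Y⟩_σ = tr (Xᴴ Y σ)`. -/
def gnsNorm {m : Type*} [Fintype m] (σ X : Matrix m m ℂ) : ℝ :=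
  Real.sqrt (Xᴴ * X * σ).trace.re

/-- The operator norm of `T : L_2(σ) → L_2(σ)`. -/
def gnsOpNorm {m : Type*} [Fintype m] (σ : Matrix m m ℂ)
    (T : Module.End ℂ (Matrix m m ℂ)) : ℝ≥0∞ :=
  ⨅ (C : ℝ≥0) (_ : ∀ X, gnsNorm σ (T X) ≤ C * gnsNorm σ X), (C : ℝ≥0∞)

/-- The `L_2`-contraction coefficient `λ`, given by `e^{-λ} = ‖Φ^* (id - P^*)‖`; it is `⊤` if this
norm is `0`. -/
def contractionCoeff {m : Type*} [Fintype m] [DecidableEq m] (σ : Matrix m m ℂ)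
    (Φ P : Module.End ℂ (Matrix m m ℂ)) : EReal :=
  -ENNReal.log (gnsOpNorm σ (hsAdjoint Φ ∘ₗ (LinearMap.id - hsAdjoint P)))

/-- The Pimsner-Popa constant `inf {C > 0 | X ≤ C P(X) for all X ≥ 0}`. -/
def pimsnerPopa {m : Type*} [Fintype m] (P : Module.End ℂ (Matrix m m ℂ)) : ℝ≥0∞ :=
  ⨅ (C : ℝ≥0) (_ : 0 < C)
    (_ : ∀ X : Matrix m m ℂ, X.PosSemidef → (((C : ℝ) : ℂ) • P X - X).PosSemidef), (C : ℝ≥0∞)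

/-- The complete Pimsner-Popa constant `Λ_c`. -/
def completePimsnerPopa {m : Type*} [Fintype m] (P : Module.End ℂ (Matrix m m ℂ)) : ℝ≥0∞ :=
  ⨆ k : ℕ, pimsnerPopa (ampliation k P)

/-- `F_c(T) = (1/d) ∑ i, ⟨i| T(|i⟩⟨i|) |i⟩`. -/
def classicalFidelity {d : ℕ} (T : Module.End ℂ (Matrix (Fin d) (Fin d) ℂ)) : ℝ :=
  (1 / (d : ℝ)) * ∑ i, (T (Matrix.single i i 1) i i).re

/-- The maximally entangled vector `(1/√d) ∑ i, |i⟩ ⊗ |i⟩`. -/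
def maxEntangled (d : ℕ) : Fin d × Fin d → ℂ :=
  fun p => if p.1 = p.2 then ((1 / Real.sqrt d : ℝ) : ℂ) else 0

/-- `F_e(T) = ⟨φ| (id ⊗ T)(|φ⟩⟨φ|) |φ⟩`, with `φ` the maximally entangled vector. -/
def entanglementFidelity {d : ℕ} (T : Module.End ℂ (Matrix (Fin d) (Fin d) ℂ)) : ℝ :=
  (star (maxEntangled d) ⬝ᵥ
    (ampliation d T (Matrix.vecMulVec (maxEntangled d) (star (maxEntangled d))) *ᵥ
      maxEntangled d)).re

variable {m : Type*} [Fintype m]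

/-- `E` is a `(d, δ)` classical code for `Φ`. -/
def IsClassicalCode (Φ : Module.End ℂ (Matrix m m ℂ)) (d : ℕ) (δ : ℝ)
    (E : Matrix (Fin d) (Fin d) ℂ →ₗ[ℂ] Matrix m m ℂ) : Prop :=
  IsChannel E ∧ ∃ D : Matrix m m ℂ →ₗ[ℂ] Matrix (Fin d) (Fin d) ℂ,
    IsChannel D ∧ 1 - δ ≤ classicalFidelity (D ∘ₗ Φ ∘ₗ E)

/-- `E` is a `(d, δ)` quantum code for `Φ`. -/
def IsQuantumCode (Φ : Module.End ℂ (Matrix m m ℂ)) (d : ℕ) (δ : ℝ)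
    (E : Matrix (Fin d) (Fin d) ℂ →ₗ[ℂ] Matrix m m ℂ) : Prop :=
  IsChannel E ∧ ∃ D : Matrix m m ℂ →ₗ[ℂ] Matrix (Fin d) (Fin d) ℂ,
    IsChannel D ∧ 1 - δ ≤ entanglementFidelity (D ∘ₗ Φ ∘ₗ E)

/-- The one-shot `δ`-error classical capacity `C_δ(Φ)`. -/
def classicalCapacity (δ : ℝ) (Φ : Module.End ℂ (Matrix m m ℂ)) : EReal :=
  ⨆ (d : ℕ) (_ : 1 ≤ d) (_ : ∃ E, IsClassicalCode Φ d δ E), ((Real.log d : ℝ) : EReal)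

/-- The one-shot `δ`-error quantum capacity `Q_δ(Φ)`. -/
def quantumCapacity (δ : ℝ) (Φ : Module.End ℂ (Matrix m m ℂ)) : EReal :=
  ⨆ (d : ℕ) (_ : 1 ≤ d) (_ : ∃ E, IsQuantumCode Φ d δ E), ((Real.log d : ℝ) : EReal)

/-- The tensor power `A^{⊗n}` of a matrix, indexed by `Fin n → m`. -/
def tensorPowMatrix (n : ℕ) (A : Matrix m m ℂ) : Matrix (Fin n → m) (Fin n → m) ℂ :=
  Matrix.of fun i j => ∏ a, A (i a) (j a)

/-- The tensor power `Φ^{⊗n}` of a linear map: it sends the matrix unit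
`E_kl = ⨂ a, E_{k_a l_a}` to `⨂ a, Φ (E_{k_a l_a})`. -/
def tensorPow [DecidableEq m] (n : ℕ) (Φ : Module.End ℂ (Matrix m m ℂ)) :
    Module.End ℂ (Matrix (Fin n → m) (Fin n → m) ℂ) where
  toFun X := Matrix.of fun i j =>
    ∑ k, ∑ l, X k l * ∏ a, Φ (Matrix.single (k a) (l a) 1) (i a) (j a)
  map_add' X Y := by
    ext i j
    simp [add_mul, Finset.sum_add_distrib]
  map_smul' c X := by
    ext i j
    simp [mul_assoc, Finset.mul_sum]

end

end QuantumCapacity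

set_option linter.unusedSectionVars false

namespace QuantumCapacity

noncomputable section

/-! ### Positive semidefinite matrices and faithfulness of the weight of `σ` -/

section Positivity

variable {m : Type*} [Fintype m]

/-! The argument runs in the Heisenberg picture. Put `Ψ = Φ^*`, a unital completely positive map
that is self-adjoint on `L_2(σ)`. Kadison-Schwarz makes it a contraction there, so it has an
orthonormal eigenbasis with real eigenvalues in `[-1, 1]`. Hence `Ψ ^ (2t)` converges to the
projection `E` onto the eigenvalues `±1`, that is, onto the fixed points of `Ψ ∘ Ψ`. Since `σ` is
faithful, equality in Kadison-Schwarz puts these fixed points in the multiplicative domain of `Ψ`.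
They form a star algebra, `E` is a conditional expectation onto it, and `P = E^*`.

The heart is an order estimate (`posSemidef_pow_sub_smul`): if `Ψ ^ t (id - E)` has `L_2` norm at
most `q` and `X ≤ Λ E(X)` for `X ≥ 0`, then `Ψ ^ t X ≥ (1 - Λ q) Ψ ^ t (E X)`. For `E y = 1` and `z
= Ψ ^ t (y - 1)`, localizing the `L_2` bound by elements of the fixed algebra gives `E(z²) ≤ q² Λ`.
The index inequality turns this into `z² ≤ Λ² q²`, so `z ≥ -Λ q`. Conjugating by the square root of
`E X` gives the general case. The `L_2` bound is inherited by every ampliation with the same `q`, so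
with `Λ = Λ_c(P)` the estimate holds in the completely positive order (`isCP_pow_sub_smul`).

By duality `Φ ^ t - c P Φ ^ t` is completely positive for some `c > 0` once `Λ q < 1`. A fidelity is
at most the factor by which a completely positive map scales the trace, so `F(Φ ^ t) - c F(P Φ ^ t)
≤ 1 - c` for any code. A perfect code for `Φ ^ t` is thus perfect for `P Φ ^ t`, which factors
through `P`. Conversely `P = Φ ^ t Φ ^ t P` factors through `Φ ^ t` (`capacities_eq`,
`capacities_pow_eq`).

For tensor powers, `gnsOpNorm_tensorPow` compares eigenvalues in the product eigenbasis, and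
`completePimsnerPopa_tensorPow` compares Choi matrices on product vectors. The one-copy result then
applies to `Φ^{⊗n}`. -/

theorem isClosed_posSemidef : IsClosed {X : Matrix m m ℂ | X.PosSemidef} := by
  have h : {X : Matrix m m ℂ | X.PosSemidef} =
      {X | Xᴴ = X} ∩ ⋂ v : m → ℂ, {X | 0 ≤ star v ⬝ᵥ (X *ᵥ v)} := by
    ext X
    simp [Matrix.posSemidef_iff_dotProduct_mulVec, Matrix.IsHermitian]
  rw [h]
  refine (isClosed_eq (by fun_prop) continuous_id).inter (isClosed_iInter fun v => ?_)
  exact isClosed_le continuous_const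
    (Continuous.dotProduct continuous_const (Continuous.matrix_mulVec continuous_id continuous_const))

theorem posSemidef_of_tendsto {α : Type*} {l : Filter α} [l.NeBot] {u : α → Matrix m m ℂ}
    {X : Matrix m m ℂ} (h : Tendsto u l (𝓝 X)) (hu : ∀ᶠ a in l, (u a).PosSemidef) :
    X.PosSemidef :=
  isClosed_posSemidef.mem_of_tendsto h hu

theorem trace_mul_vecMulVec (X : Matrix m m ℂ) (v : m → ℂ) :
    (X * Matrix.vecMulVec v (star v)).trace = star v ⬝ᵥ (X *ᵥ v) := by
  rw [Matrix.mul_vecMulVec, Matrix.trace_vecMulVec, dotProduct_comm]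

open scoped MatrixOrder in
theorem exists_eq_conjTranspose_mul_self {X : Matrix m m ℂ} (hX : X.PosSemidef) :
    ∃ B : Matrix m m ℂ, X = Bᴴ * B := by
  classical
  exact CStarAlgebra.nonneg_iff_eq_star_mul_self.mp hX.nonneg

theorem trace_mul_nonneg {X Y : Matrix m m ℂ} (hX : X.PosSemidef) (hY : Y.PosSemidef) :
    0 ≤ (X * Y).trace := by
  classical
  obtain ⟨B, rfl⟩ := exists_eq_conjTranspose_mul_self hY
  rw [← Matrix.mul_assoc, Matrix.trace_mul_comm, ← Matrix.mul_assoc]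
  exact (hX.mul_mul_conjTranspose_same B).trace_nonneg

theorem exists_ofReal_eq_trace_mul {X Y : Matrix m m ℂ} (hX : X.PosSemidef)
    (hY : Y.PosSemidef) : ∃ x : ℝ, 0 ≤ x ∧ (x : ℂ) = (X * Y).trace := by
  have h := Complex.nonneg_iff.mp (trace_mul_nonneg hX hY)
  exact ⟨_, h.1, Complex.ext rfl h.2⟩

theorem posSemidef_smul {X : Matrix m m ℂ} (hX : X.PosSemidef) {c : ℝ} (hc : 0 ≤ c) :
    ((c : ℂ) • X).PosSemidef :=
  hX.smul (by exact_mod_cast hc)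

/-- The trace is the sum of the quadratic form of `σ` over the conjugated rows of `A`, so one
nonzero row would make it positive. -/
theorem eq_zero_of_trace_mul_eq_zero {σ : Matrix m m ℂ} (hσ : σ.PosDef) {A : Matrix m m ℂ}
    (h : (Aᴴ * A * σ).trace = 0) : A = 0 := by
  classical
  by_contra hA
  obtain ⟨i, hi⟩ : ∃ i, star (A i) ≠ 0 := by
    by_contra! hc
    exact hA (by ext i j; simpa using congrFun (hc i) j)
  have key : (Aᴴ * A * σ).trace = ∑ i, star (star (A i)) ⬝ᵥ (σ *ᵥ star (A i)) := by
    rw [Matrix.mul_assoc, Matrix.trace_mul_comm, Matrix.trace]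
    refine Finset.sum_congr rfl fun i _ => ?_
    simp [Matrix.mul_apply, dotProduct, Matrix.mulVec, Finset.mul_sum, mul_assoc]
  have hpos : 0 < ∑ i, star (star (A i)) ⬝ᵥ (σ *ᵥ star (A i)) :=
    Finset.sum_pos' (fun i _ => hσ.posSemidef.dotProduct_mulVec_nonneg _)
      ⟨i, Finset.mem_univ _, hσ.dotProduct_mulVec_pos hi⟩
  rw [← key, h] at hpos
  exact lt_irrefl _ hpos

end Positivity

/-! ### Completely positive maps, Choi matrices and Kraus operators -/

section Kraus

variable {ι m n p : Type*} [Fintype ι] [Fintype m] [Fintype n] [Fintype p]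

/-- The completely positive map `X ↦ ∑ r, K r * X * (K r)ᴴ` with Kraus operators `K r`. -/
def krausMap (K : ι → Matrix n m ℂ) : Matrix m m ℂ →ₗ[ℂ] Matrix n n ℂ where
  toFun X := ∑ r, K r * X * (K r)ᴴ
  map_add' X Y := by simp [Matrix.mul_add, Matrix.add_mul, Finset.sum_add_distrib]
  map_smul' c X := by simp [Finset.smul_sum]

theorem krausMap_apply (K : ι → Matrix n m ℂ) (X : Matrix m m ℂ) :
    krausMap K X = ∑ r, K r * X * (K r)ᴴ := rfl

theorem krausMap_posSemidef (K : ι → Matrix n m ℂ) {X : Matrix m m ℂ} (hX : X.PosSemidef) :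
    (krausMap K X).PosSemidef :=
  Matrix.posSemidef_sum _ fun r _ => hX.mul_mul_conjTranspose_same (K r)

theorem krausMap_conjTranspose (K : ι → Matrix n m ℂ) (X : Matrix m m ℂ) :
    krausMap K Xᴴ = (krausMap K X)ᴴ := by
  simp [krausMap_apply, Matrix.conjTranspose_sum, Matrix.mul_assoc]

/-- Complete positivity. -/
def IsCP (Φ : Matrix m m ℂ →ₗ[ℂ] Matrix n n ℂ) : Prop :=
  ∀ (k : ℕ) (X : Matrix (Fin k × m) (Fin k × m) ℂ), X.PosSemidef → (ampliation k Φ X).PosSemidef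

theorem ampliation_apply (k : ℕ) (Φ : Matrix m m ℂ →ₗ[ℂ] Matrix n n ℂ)
    (X : Matrix (Fin k × m) (Fin k × m) ℂ) (a b : Fin k × n) :
    ampliation k Φ X a b = Φ (Matrix.of fun i j => X (a.1, i) (b.1, j)) a.2 b.2 := rfl

theorem ampliation_sub (k : ℕ) (Ψ Φ : Matrix m m ℂ →ₗ[ℂ] Matrix n n ℂ) :
    ampliation k (Ψ - Φ) = ampliation k Ψ - ampliation k Φ := rfl

theorem ampliation_smul (k : ℕ) (c : ℂ) (Φ : Matrix m m ℂ →ₗ[ℂ] Matrix n n ℂ) :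
    ampliation k (c • Φ) = c • ampliation k Φ := rfl

theorem ampliation_pow (k : ℕ) (Φ : Module.End ℂ (Matrix m m ℂ)) (t : ℕ) :
    ampliation k (Φ ^ t) = (ampliation k Φ : Module.End ℂ _) ^ t := by
  induction t with
  | zero => rfl
  | succ t ih => rw [pow_succ, pow_succ, ← ih]; rfl

open scoped Kronecker in
theorem ampliation_krausMap (k : ℕ) (K : ι → Matrix n m ℂ) :
    ampliation k (krausMap K) =
      krausMap fun r => (1 : Matrix (Fin k) (Fin k) ℂ) ⊗ₖ K r := by
  ext X a b
  obtain ⟨a, i⟩ := a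
  obtain ⟨b, j⟩ := b
  simp only [ampliation_apply, krausMap_apply, Matrix.sum_apply]
  refine Finset.sum_congr rfl fun r _ => ?_
  simp [Matrix.mul_apply, Fintype.sum_prod_type, Matrix.one_apply, Matrix.kroneckerMap_apply,
    apply_ite (starRingEnd ℂ), Finset.sum_ite_irrel]

theorem isCP_krausMap (K : ι → Matrix n m ℂ) : IsCP (krausMap K) := fun k X hX => by
  rw [ampliation_krausMap]
  exact krausMap_posSemidef _ hX

theorem IsCP.comp {Ψ : Matrix n n ℂ →ₗ[ℂ] Matrix p p ℂ} {Φ : Matrix m m ℂ →ₗ[ℂ] Matrix n n ℂ}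
    (hΨ : IsCP Ψ) (hΦ : IsCP Φ) : IsCP (Ψ ∘ₗ Φ) := fun k X hX => hΨ k _ (hΦ k X hX)

theorem IsCP.posSemidef {Φ : Matrix m m ℂ →ₗ[ℂ] Matrix n n ℂ} (hΦ : IsCP Φ) {X : Matrix m m ℂ}
    (hX : X.PosSemidef) : (Φ X).PosSemidef :=
  (hΦ 1 _ (hX.submatrix Prod.snd)).submatrix fun i => ((0 : Fin 1), i)

theorem IsChannel.isCP {Φ : Matrix m m ℂ →ₗ[ℂ] Matrix n n ℂ} (hΦ : IsChannel Φ) : IsCP Φ :=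
  hΦ.completelyPositive

theorem IsChannel.comp {Ψ : Matrix n n ℂ →ₗ[ℂ] Matrix p p ℂ}
    {Φ : Matrix m m ℂ →ₗ[ℂ] Matrix n n ℂ} (hΨ : IsChannel Ψ) (hΦ : IsChannel Φ) :
    IsChannel (Ψ ∘ₗ Φ) :=
  ⟨hΨ.isCP.comp hΦ.isCP, fun X => by simp [hΨ.tracePreserving, hΦ.tracePreserving]⟩

theorem IsChannel.pow {Φ : Module.End ℂ (Matrix m m ℂ)} (hΦ : IsChannel Φ) (t : ℕ) :
    IsChannel (Φ ^ t) := by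
  induction t with
  | zero => exact ⟨fun k X hX => hX, fun X => rfl⟩
  | succ t ih => exact ih.comp hΦ

/-- The Choi matrix `∑ i j, E_ij ⊗ Φ (E_ij)`. -/
def choi [DecidableEq m] (Φ : Matrix m m ℂ →ₗ[ℂ] Matrix n n ℂ) : Matrix (m × n) (m × n) ℂ :=
  Matrix.of fun a b => Φ (Matrix.single a.1 b.1 1) a.2 b.2

/-- The Choi matrix is, after reindexing `m` by `Fin (card m)`, the ampliation applied to the
rank-one matrix of the unnormalized maximally entangled vector. -/
theorem IsCP.choi_posSemidef [DecidableEq m] {Φ : Matrix m m ℂ →ₗ[ℂ] Matrix n n ℂ}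
    (hΦ : IsCP Φ) : (choi Φ).PosSemidef := by
  let e := Fintype.equivFin m
  let v : Fin (Fintype.card m) × m → ℂ := fun a => if e.symm a.1 = a.2 then 1 else 0
  have h := (hΦ _ _ (Matrix.posSemidef_vecMulVec_self_star v)).submatrix
    fun a : m × n => (e a.1, a.2)
  convert h using 1
  ext a b
  simp only [choi, Matrix.of_apply, Matrix.submatrix_apply, ampliation_apply]
  have h' : (Matrix.of fun i j => Matrix.vecMulVec v (star v) (e a.1, i) (e b.1, j)) =
      Matrix.single a.1 b.1 1 := by
    ext i j
    simp only [Matrix.of_apply, Matrix.single_apply, v, Matrix.vecMulVec_apply, ite_and,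
      Equiv.symm_apply_apply, Pi.star_apply]
    split_ifs <;> simp
  rw [h']

theorem linearMap_apply_eq_sum [DecidableEq m] (Φ : Matrix m m ℂ →ₗ[ℂ] Matrix n n ℂ)
    (X : Matrix m m ℂ) : Φ X = ∑ i, ∑ j, X i j • Φ (Matrix.single i j 1) := by
  conv_lhs => rw [Matrix.matrix_eq_sum_single X]
  simp only [map_sum, ← map_smul, Matrix.smul_single, smul_eq_mul, mul_one]

theorem ext_single [DecidableEq m] {Φ Ψ : Matrix m m ℂ →ₗ[ℂ] Matrix n n ℂ}
    (h : ∀ i j, Φ (Matrix.single i j 1) = Ψ (Matrix.single i j 1)) : Φ = Ψ := by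
  ext1 X
  rw [linearMap_apply_eq_sum Φ, linearMap_apply_eq_sum Ψ]
  simp only [h]

/-- Factor the Choi matrix as `Bᴴ * B`; each row of `B`, conjugated and reshaped, is a Kraus
operator. -/
theorem exists_krausMap_of_choi_posSemidef [DecidableEq m]
    {Φ : Matrix m m ℂ →ₗ[ℂ] Matrix n n ℂ} (hΦ : (choi Φ).PosSemidef) :
    ∃ K : m × n → Matrix n m ℂ, Φ = krausMap K := by
  classical
  obtain ⟨B, hB⟩ := exists_eq_conjTranspose_mul_self hΦ
  refine ⟨fun r => Matrix.of fun a i => star (B r (i, a)), ext_single fun i j => ?_⟩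
  ext a b
  have := congrFun (congrFun hB (i, a)) (j, b)
  simp only [choi, Matrix.of_apply] at this
  rw [this, krausMap_apply, Matrix.sum_apply, Matrix.mul_apply]
  refine Finset.sum_congr rfl fun r _ => ?_
  simp [Matrix.mul_apply, Matrix.single_apply, ite_and]

theorem isCP_iff_choi_posSemidef [DecidableEq m] {Φ : Matrix m m ℂ →ₗ[ℂ] Matrix n n ℂ} :
    IsCP Φ ↔ (choi Φ).PosSemidef := by
  refine ⟨IsCP.choi_posSemidef, fun h => ?_⟩
  obtain ⟨K, rfl⟩ := exists_krausMap_of_choi_posSemidef h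
  exact isCP_krausMap K

theorem IsCP.exists_krausMap {Φ : Matrix m m ℂ →ₗ[ℂ] Matrix n n ℂ} (hΦ : IsCP Φ) :
    ∃ K : m × n → Matrix n m ℂ, Φ = krausMap K := by
  classical
  exact exists_krausMap_of_choi_posSemidef hΦ.choi_posSemidef

end Kraus

/-! ### The Hilbert-Schmidt adjoint -/

section Adjoint

variable {ι m : Type*} [Fintype ι] [Fintype m] [DecidableEq m]

theorem eq_of_trace_conjTranspose_mul_eq {A B : Matrix m m ℂ}
    (h : ∀ X : Matrix m m ℂ, (Xᴴ * A).trace = (Xᴴ * B).trace) : A = B := by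
  rw [← sub_eq_zero, ← Matrix.trace_conjTranspose_mul_self_eq_zero_iff, Matrix.mul_sub,
    Matrix.trace_sub, h, sub_self]

theorem hsAdjoint_eq_of_forall {Φ Ψ : Module.End ℂ (Matrix m m ℂ)}
    (h : ∀ X Y : Matrix m m ℂ, (Xᴴ * Ψ Y).trace = ((Φ X)ᴴ * Y).trace) : hsAdjoint Φ = Ψ := by
  ext1 Y
  exact eq_of_trace_conjTranspose_mul_eq fun X => by rw [trace_conjTranspose_mul_hsAdjoint, h]

theorem hsAdjoint_krausMap (K : ι → Matrix m m ℂ) :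
    hsAdjoint (krausMap K) = krausMap fun r => (K r)ᴴ := by
  refine hsAdjoint_eq_of_forall fun X Y => ?_
  simp only [krausMap_apply, Matrix.mul_sum, Matrix.conjTranspose_sum, Matrix.sum_mul,
    Matrix.trace_sum, Matrix.conjTranspose_mul, Matrix.conjTranspose_conjTranspose]
  refine Finset.sum_congr rfl fun r _ => ?_
  rw [← Matrix.mul_assoc, Matrix.trace_mul_comm]
  simp only [Matrix.mul_assoc]

theorem hsAdjoint_comp (Φ Ψ : Module.End ℂ (Matrix m m ℂ)) :
    hsAdjoint (Φ * Ψ) = hsAdjoint Ψ * hsAdjoint Φ :=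
  hsAdjoint_eq_of_forall fun X Y => by
    simp [trace_conjTranspose_mul_hsAdjoint]

theorem hsAdjoint_pow (Φ : Module.End ℂ (Matrix m m ℂ)) (t : ℕ) :
    hsAdjoint (Φ ^ t) = hsAdjoint Φ ^ t := by
  induction t with
  | zero => exact hsAdjoint_eq_of_forall fun X Y => rfl
  | succ t ih => rw [pow_succ, pow_succ', hsAdjoint_comp, ih]

theorem hsAdjoint_hsAdjoint (Φ : Module.End ℂ (Matrix m m ℂ)) : hsAdjoint (hsAdjoint Φ) = Φ :=
  hsAdjoint_eq_of_forall fun X Y => by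
    have h := congrArg star (trace_conjTranspose_mul_hsAdjoint Φ Y X)
    rw [← Matrix.trace_conjTranspose, ← Matrix.trace_conjTranspose] at h
    simpa using h.symm

theorem hsAdjoint_sub (Φ Ψ : Module.End ℂ (Matrix m m ℂ)) :
    hsAdjoint (Φ - Ψ) = hsAdjoint Φ - hsAdjoint Ψ :=
  hsAdjoint_eq_of_forall fun X Y => by
    simp [Matrix.mul_sub, Matrix.sub_mul, trace_conjTranspose_mul_hsAdjoint]

theorem hsAdjoint_one : hsAdjoint (1 : Module.End ℂ (Matrix m m ℂ)) = 1 :=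
  hsAdjoint_eq_of_forall fun _ _ => rfl

theorem isCP_hsAdjoint {Φ : Module.End ℂ (Matrix m m ℂ)} (hΦ : IsCP Φ) :
    IsCP (hsAdjoint Φ) := by
  obtain ⟨K, rfl⟩ := hΦ.exists_krausMap
  rw [hsAdjoint_krausMap]
  exact isCP_krausMap _

theorem hsAdjoint_conjTranspose {Φ : Module.End ℂ (Matrix m m ℂ)} (hΦ : IsCP Φ)
    (X : Matrix m m ℂ) : hsAdjoint Φ Xᴴ = (hsAdjoint Φ X)ᴴ := by
  obtain ⟨K, rfl⟩ := hΦ.exists_krausMap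
  rw [hsAdjoint_krausMap, krausMap_conjTranspose]

/-- The Hilbert-Schmidt pairing of a positivity-preserving map and its adjoint. -/
theorem trace_hsAdjoint_mul {Φ : Module.End ℂ (Matrix m m ℂ)} (hΦ : IsCP Φ) (X Y : Matrix m m ℂ) :
    (hsAdjoint Φ Y * X).trace = (Y * Φ X).trace := by
  have h := trace_conjTranspose_mul_hsAdjoint (hsAdjoint Φ) Yᴴ X
  rw [hsAdjoint_hsAdjoint, hsAdjoint_conjTranspose hΦ] at h
  simpa using h.symm

theorem hsAdjoint_map_one {Φ : Module.End ℂ (Matrix m m ℂ)} (hΦ : IsChannel Φ) :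
    hsAdjoint Φ 1 = 1 :=
  eq_of_trace_conjTranspose_mul_eq fun X => by
    rw [trace_conjTranspose_mul_hsAdjoint, Matrix.mul_one, Matrix.mul_one,
      Matrix.trace_conjTranspose, Matrix.trace_conjTranspose, hΦ.tracePreserving]

end Adjoint

/-! ### Kadison-Schwarz and the multiplicative domain -/

section Schwarz

variable {ι n : Type*} [Fintype ι] [Fintype n] [DecidableEq n]

/-- The defect in the Kadison-Schwarz inequality of a unital completely positive map. -/
theorem krausMap_schwarz_defect (L : ι → Matrix n n ℂ) (h1 : krausMap L 1 = 1)
    (X : Matrix n n ℂ) :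
    krausMap L (Xᴴ * X) - (krausMap L X)ᴴ * krausMap L X =
      ∑ r, (X * (L r)ᴴ - (L r)ᴴ * krausMap L X)ᴴ * (X * (L r)ᴴ - (L r)ᴴ * krausMap L X) := by
  set Z := krausMap L X with hZ
  have hone : ∑ r, L r * (L r)ᴴ = 1 := by simpa [krausMap_apply] using h1
  have e : ∀ r, (X * (L r)ᴴ - (L r)ᴴ * Z)ᴴ * (X * (L r)ᴴ - (L r)ᴴ * Z) =
      L r * (Xᴴ * X) * (L r)ᴴ - (L r * Xᴴ * (L r)ᴴ) * Z - Zᴴ * (L r * X * (L r)ᴴ) +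
        Zᴴ * (L r * (L r)ᴴ) * Z := fun r => by
    simp only [Matrix.conjTranspose_sub, Matrix.conjTranspose_mul,
      Matrix.conjTranspose_conjTranspose]
    noncomm_ring
  simp only [e, Finset.sum_add_distrib, Finset.sum_sub_distrib, ← Finset.sum_mul,
    ← Finset.mul_sum, hone]
  rw [← krausMap_apply, ← krausMap_apply, ← krausMap_apply, krausMap_conjTranspose, ← hZ]
  noncomm_ring

/-- A unital completely positive map that is symmetric for the GNS inner product of `σ`. -/
structure IsSymmUnitalCP (Ψ : Module.End ℂ (Matrix n n ℂ)) (σ : Matrix n n ℂ) : Prop where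
  isCP : IsCP Ψ
  map_one : Ψ 1 = 1
  symm : ∀ X Y : Matrix n n ℂ, (X * Ψ Y * σ).trace = (Ψ X * Y * σ).trace

theorem isSymmUnitalCP_hsAdjoint {Φ : Module.End ℂ (Matrix n n ℂ)} {σ : Matrix n n ℂ}
    (hΦ : IsChannel Φ) (h : IsGNSSymmetric Φ σ) : IsSymmUnitalCP (hsAdjoint Φ) σ :=
  ⟨isCP_hsAdjoint hΦ.isCP, hsAdjoint_map_one hΦ, h⟩

theorem IsCP.map_conjTranspose {Ψ : Module.End ℂ (Matrix n n ℂ)} (hΨ : IsCP Ψ)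
    (X : Matrix n n ℂ) : Ψ Xᴴ = (Ψ X)ᴴ := by
  obtain ⟨L, rfl⟩ := hΨ.exists_krausMap
  exact krausMap_conjTranspose L X

namespace IsSymmUnitalCP

variable {Ψ : Module.End ℂ (Matrix n n ℂ)} {σ : Matrix n n ℂ} (h : IsSymmUnitalCP Ψ σ)
include h

theorem trace_map (X : Matrix n n ℂ) : (Ψ X * σ).trace = (X * σ).trace := by
  simpa [h.map_one] using (h.symm X 1).symm

theorem trace_pow (t : ℕ) (X : Matrix n n ℂ) : ((Ψ ^ t) X * σ).trace = (X * σ).trace := by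
  induction t with
  | zero => rfl
  | succ t ih => rw [pow_succ', Module.End.mul_apply, h.trace_map, ih]

theorem pow_conjTranspose (t : ℕ) (X : Matrix n n ℂ) : (Ψ ^ t) Xᴴ = ((Ψ ^ t) X)ᴴ := by
  induction t with
  | zero => rfl
  | succ t ih => rw [pow_succ', Module.End.mul_apply, ih, h.isCP.map_conjTranspose]; rfl

theorem pow_posSemidef (t : ℕ) {X : Matrix n n ℂ} (hX : X.PosSemidef) :
    ((Ψ ^ t) X).PosSemidef := by
  induction t with
  | zero => exact hX
  | succ t ih => rw [pow_succ', Module.End.mul_apply]; exact h.isCP.posSemidef ih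

theorem schwarz (X : Matrix n n ℂ) : (Ψ (Xᴴ * X) - (Ψ X)ᴴ * Ψ X).PosSemidef := by
  obtain ⟨L, hL⟩ := h.isCP.exists_krausMap
  have h1 := h.map_one
  rw [hL] at h1 ⊢
  rw [krausMap_schwarz_defect L h1]
  exact Matrix.posSemidef_sum _ fun r _ => Matrix.posSemidef_conjTranspose_mul_self _

theorem trace_map_le (hσ : σ.PosDef) (X : Matrix n n ℂ) :
    ((Ψ X)ᴴ * Ψ X * σ).trace ≤ (Xᴴ * X * σ).trace := by
  rw [← h.trace_map (Xᴴ * X), ← sub_nonneg, ← Matrix.trace_sub, ← Matrix.sub_mul]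
  exact trace_mul_nonneg (h.schwarz X) hσ.posSemidef

/-- Equality of norms makes the weight of the Schwarz defect vanish. The defect is a sum of squares
and `σ` is faithful, so `X` intertwines each Kraus operator: `X * (L r)ᴴ = (L r)ᴴ * Ψ X`.
Multiplicativity on the right follows term by term. -/
theorem map_mul_of_trace_eq (hσ : σ.PosDef) {X : Matrix n n ℂ}
    (hX : ((Ψ X)ᴴ * Ψ X * σ).trace = (Xᴴ * X * σ).trace) (Y : Matrix n n ℂ) :
    Ψ (Y * X) = Ψ Y * Ψ X := by
  obtain ⟨L, hL⟩ := h.isCP.exists_krausMap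
  have h1 := h.map_one
  have hd : ((Ψ (Xᴴ * X) - (Ψ X)ᴴ * Ψ X) * σ).trace = 0 := by
    rw [Matrix.sub_mul, Matrix.trace_sub, h.trace_map, hX, sub_self]
  rw [hL] at h1 hd ⊢
  rw [krausMap_schwarz_defect L h1, Finset.sum_mul, Matrix.trace_sum] at hd
  have hr : ∀ r, X * (L r)ᴴ = (L r)ᴴ * krausMap L X := fun r => by
    rw [← sub_eq_zero]
    refine eq_zero_of_trace_mul_eq_zero hσ ?_
    exact (Finset.sum_eq_zero_iff_of_nonneg fun r _ => trace_mul_nonneg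
      (Matrix.posSemidef_conjTranspose_mul_self _) hσ.posSemidef).mp hd r (Finset.mem_univ r)
  rw [krausMap_apply, krausMap_apply L Y, Finset.sum_mul]
  refine Finset.sum_congr rfl fun r _ => ?_
  rw [Matrix.mul_assoc, Matrix.mul_assoc Y X, hr, Matrix.mul_assoc, Matrix.mul_assoc]

/-- The contraction `Ψ` preserves the norm of `a`, because a second application recovers `a`. -/
theorem map_mul_of_fixed (hσ : σ.PosDef) {a : Matrix n n ℂ} (ha : Ψ (Ψ a) = a)
    (Y : Matrix n n ℂ) : Ψ (Y * a) = Ψ Y * Ψ a := by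
  refine h.map_mul_of_trace_eq hσ (le_antisymm (h.trace_map_le hσ a) ?_) Y
  simpa [ha] using h.trace_map_le hσ (Ψ a)

omit h in
theorem pow_mem_of_fixed {a : Matrix n n ℂ} (ha : Ψ (Ψ a) = a) (t : ℕ) :
    Ψ (Ψ ((Ψ ^ t) a)) = (Ψ ^ t) a := by
  induction t with
  | zero => exact ha
  | succ t ih => rw [pow_succ', Module.End.mul_apply, ih]

omit h in
theorem pow_two_mul_of_fixed {a : Matrix n n ℂ} (ha : Ψ (Ψ a) = a) (t : ℕ) :
    (Ψ ^ (2 * t)) a = a := by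
  induction t with
  | zero => rfl
  | succ t ih =>
    rw [show 2 * (t + 1) = 2 * t + 1 + 1 by ring, pow_succ, pow_succ, Module.End.mul_apply,
      Module.End.mul_apply, ha, ih]

theorem pow_mul_of_fixed (hσ : σ.PosDef) {a : Matrix n n ℂ} (ha : Ψ (Ψ a) = a)
    (t : ℕ) (Y : Matrix n n ℂ) : (Ψ ^ t) (Y * a) = (Ψ ^ t) Y * (Ψ ^ t) a := by
  induction t with
  | zero => rfl
  | succ t ih =>
    simp only [pow_succ', Module.End.mul_apply]
    rw [ih, h.map_mul_of_fixed hσ (pow_mem_of_fixed ha t)]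

/-- The algebra of fixed points of `Ψ ∘ Ψ`. -/
def fixedAlgebra (hσ : σ.PosDef) : StarSubalgebra ℂ (Matrix n n ℂ) where
  carrier := {a | Ψ (Ψ a) = a}
  mul_mem' {a b} ha hb := by
    have hb' : Ψ (Ψ (Ψ b)) = Ψ b := congrArg Ψ hb
    change Ψ (Ψ (a * b)) = a * b
    rw [h.map_mul_of_fixed hσ hb, h.map_mul_of_fixed hσ hb', ha, hb]
  add_mem' {a b} ha hb := by
    change Ψ (Ψ (a + b)) = a + b
    rw [map_add, map_add, ha, hb]
  algebraMap_mem' c := by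
    change Ψ (Ψ (algebraMap ℂ (Matrix n n ℂ) c)) = _
    rw [Algebra.algebraMap_eq_smul_one, map_smul, map_smul, h.map_one, h.map_one]
  star_mem' {a} ha := by
    change Ψ (Ψ aᴴ) = aᴴ
    rw [h.isCP.map_conjTranspose, h.isCP.map_conjTranspose, ha]

/-- Finite dimension makes the star algebra closed, hence stable under functional calculus. This
supplies the square roots and spectral test elements used in the order estimate. -/
theorem cfc_fixed (hσ : σ.PosDef) {a : Matrix n n ℂ} (ha : Ψ (Ψ a) = a) (f : ℝ → ℝ) :
    Ψ (Ψ (cfc f a)) = cfc f a := by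
  have hc : IsClosed (h.fixedAlgebra hσ : Set (Matrix n n ℂ)) :=
    Submodule.closed_of_finiteDimensional (h.fixedAlgebra hσ).toSubalgebra.toSubmodule
  exact cfc_mem (s := h.fixedAlgebra hσ) (𝕜' := ℂ) f ha

end IsSymmUnitalCP

end Schwarz

/-! ### Functional calculus and elementary operator inequalities -/

section FunctionalCalculus

variable {n : Type*} [Fintype n] [DecidableEq n]

theorem continuousOn_spectrum (f : ℝ → ℝ) (A : Matrix n n ℂ) : ContinuousOn f (spectrum ℝ A) :=
  Matrix.finite_real_spectrum.continuousOn f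

theorem spectrum_pos_of_posDef {A : Matrix n n ℂ} (hA : A.PosDef) {x : ℝ}
    (hx : x ∈ spectrum ℝ A) : 0 < x := by
  rw [hA.1.spectrum_real_eq_range_eigenvalues] at hx
  obtain ⟨i, rfl⟩ := hx
  exact hA.eigenvalues_pos i

theorem cfc_mul_cfc (f g : ℝ → ℝ) (A : Matrix n n ℂ) :
    cfc f A * cfc g A = cfc (fun x => f x * g x) A :=
  (cfc_mul f g A (continuousOn_spectrum f A) (continuousOn_spectrum g A)).symm

theorem cfc_conjTranspose (f : ℝ → ℝ) (A : Matrix n n ℂ) : (cfc f A)ᴴ = cfc f A :=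
  cfc_predicate (R := ℝ) (p := IsSelfAdjoint) f A

/-- If `a * D * a` has nonnegative weight for all `a = f(D)`, then `D` is positive. -/
theorem posSemidef_of_trace_cfc_nonneg {σ D : Matrix n n ℂ} (hσ : σ.PosDef) (hD : D.IsHermitian)
    (h : ∀ f : ℝ → ℝ, 0 ≤ (cfc f D * D * cfc f D * σ).trace) : D.PosSemidef := by
  have hDs : IsSelfAdjoint D := hD
  have hid : cfc (fun x : ℝ => x) D = D := cfc_id' ℝ D
  set c := cfc (fun x : ℝ => max (-x) 0) D with hc
  have hcH : cᴴ = c := cfc_conjTranspose _ D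
  -- The test function is the square root of the negative part `c`: it compresses `D` to `-c²`, so
  -- nonnegativity of the weight forces `c = 0`.
  have hcc : cfc (fun x : ℝ => √(max (-x) 0)) D * D * cfc (fun x : ℝ => √(max (-x) 0)) D =
      -(cᴴ * c) := by
    rw [hcH]
    nth_rewrite 2 [← hid]
    rw [cfc_mul_cfc, cfc_mul_cfc, hc, cfc_mul_cfc, ← cfc_neg]
    refine cfc_congr fun x _ => ?_
    have := Real.mul_self_sqrt (le_max_right (-x) 0)
    rcases le_total 0 x with hx | hx
    · simp [hx]
    · rw [max_eq_left (by linarith)] at this ⊢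
      linear_combination x * this
  have h0 : c = 0 := by
    refine eq_zero_of_trace_mul_eq_zero hσ (le_antisymm ?_ ?_)
    · have := h fun x => √(max (-x) 0)
      rw [hcc, Matrix.neg_mul, Matrix.trace_neg] at this
      exact neg_nonneg.mp this
    · exact trace_mul_nonneg (Matrix.posSemidef_conjTranspose_mul_self c) hσ.posSemidef
  have hsq : D + c = (cfc (fun x : ℝ => √(max x 0)) D)ᴴ * cfc (fun x : ℝ => √(max x 0)) D := by
    rw [cfc_conjTranspose, cfc_mul_cfc, hc]
    nth_rewrite 1 [← hid]
    rw [← cfc_add D _ _ (continuousOn_spectrum _ D) (continuousOn_spectrum _ D)]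
    refine cfc_congr fun x _ => ?_
    rw [Real.mul_self_sqrt (le_max_right x 0)]
    rcases le_total 0 x with hx | hx
    · simp [hx]
    · simp [hx]
  rw [h0, add_zero] at hsq
  rw [hsq]
  exact Matrix.posSemidef_conjTranspose_mul_self _

/-- Rests on the identity `y (Λ - y) y + (Λ - y) y (Λ - y) = Λ (Λ y - y²)`. -/
theorem posSemidef_sub_sq {Λ : ℝ} (hΛ : 0 < Λ) {y : Matrix n n ℂ} (hy : y.PosSemidef)
    (h : ((Λ : ℂ) • (1 : Matrix n n ℂ) - y).PosSemidef) : ((Λ : ℂ) • y - y * y).PosSemidef := by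
  have h1 := (h.conjTranspose_mul_mul_same y).add (hy.conjTranspose_mul_mul_same ((Λ : ℂ) • 1 - y))
  rw [h.1, hy.1] at h1
  have h2 := posSemidef_smul h1 (inv_nonneg.mpr hΛ.le)
  convert h2 using 1
  have e : y * ((Λ : ℂ) • 1 - y) * y + ((Λ : ℂ) • 1 - y) * y * ((Λ : ℂ) • 1 - y) =
      (Λ : ℂ) • ((Λ : ℂ) • y - y * y) := by
    simp only [Matrix.mul_sub, Matrix.sub_mul, Matrix.smul_mul, Matrix.mul_smul, Matrix.one_mul,
      Matrix.mul_one, smul_sub]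
    abel
  rw [e, smul_smul, ← Complex.ofReal_mul, inv_mul_cancel₀ hΛ.ne', Complex.ofReal_one, one_smul]

/-- Rests on the identity `(z + c)² + (c² - z²) = 2c (z + c)`. -/
theorem posSemidef_add_of_sq_le {c : ℝ} (hc : 0 < c) {z : Matrix n n ℂ} (hz : z.IsHermitian)
    (h : (((c ^ 2 : ℝ) : ℂ) • (1 : Matrix n n ℂ) - z * z).PosSemidef) :
    (z + (c : ℂ) • 1).PosSemidef := by
  have hH : (z + (c : ℂ) • (1 : Matrix n n ℂ))ᴴ = z + (c : ℂ) • 1 := by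
    simp [hz.eq]
  have h1 := (Matrix.posSemidef_conjTranspose_mul_self (z + (c : ℂ) • (1 : Matrix n n ℂ))).add h
  rw [hH] at h1
  have h2 := posSemidef_smul h1 (c := (2 * c)⁻¹) (by positivity)
  convert h2 using 1
  have e : (z + (c : ℂ) • 1) * (z + (c : ℂ) • 1) + (((c ^ 2 : ℝ) : ℂ) • 1 - z * z) =
      ((2 * c : ℝ) : ℂ) • (z + (c : ℂ) • (1 : Matrix n n ℂ)) := by
    simp only [Matrix.mul_add, Matrix.add_mul, Matrix.smul_mul, Matrix.mul_smul, Matrix.one_mul,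
      Matrix.mul_one, smul_add, smul_smul]
    push_cast
    module
  rw [e, smul_smul, ← Complex.ofReal_mul, inv_mul_cancel₀ (by positivity), Complex.ofReal_one,
    one_smul]

end FunctionalCalculus

/-! ### The limit of even powers as a conditional expectation -/

section EvenLimit

variable {n : Type*} [Fintype n] [DecidableEq n]

theorem continuous_end (T : Module.End ℂ (Matrix n n ℂ)) : Continuous T :=
  LinearMap.continuous_of_finiteDimensional T

/-- `E` is the limit of the even powers of `Ψ`. -/
def IsEvenLimit (Ψ E : Module.End ℂ (Matrix n n ℂ)) : Prop :=
  ∀ X, Tendsto (fun t : ℕ => (Ψ ^ (2 * t)) X) atTop (𝓝 (E X))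

namespace IsEvenLimit

variable {Ψ E : Module.End ℂ (Matrix n n ℂ)} (hE : IsEvenLimit Ψ E)
include hE

theorem map_map (X : Matrix n n ℂ) : Ψ (Ψ (E X)) = E X := by
  have h1 : Tendsto (fun t : ℕ => Ψ (Ψ ((Ψ ^ (2 * t)) X))) atTop (𝓝 (Ψ (Ψ (E X)))) :=
    (((continuous_end Ψ).comp (continuous_end Ψ)).tendsto _).comp (hE X)
  have h2 := (hE X).comp (tendsto_add_atTop_nat 1)
  refine tendsto_nhds_unique h1 (h2.congr fun t => ?_)
  simp only [Function.comp_apply]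
  rw [show 2 * (t + 1) = 2 * t + 1 + 1 by ring, pow_succ', pow_succ']
  rfl

theorem apply_of_fixed {a : Matrix n n ℂ} (ha : Ψ (Ψ a) = a) : E a = a :=
  tendsto_nhds_unique (hE a) (tendsto_const_nhds.congr fun t =>
    (IsSymmUnitalCP.pow_two_mul_of_fixed ha t).symm)

theorem apply_apply (X : Matrix n n ℂ) : E (E X) = E X := hE.apply_of_fixed (hE.map_map X)

theorem pow_two_mul_apply (t : ℕ) (X : Matrix n n ℂ) : (Ψ ^ (2 * t)) (E X) = E X :=
  IsSymmUnitalCP.pow_two_mul_of_fixed (hE.map_map X) t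

theorem pow_comm (s : ℕ) (X : Matrix n n ℂ) : E ((Ψ ^ s) X) = (Ψ ^ s) (E X) := by
  refine tendsto_nhds_unique (hE _)
    ((((continuous_end (Ψ ^ s)).tendsto _).comp (hE X)).congr fun t => ?_)
  simp only [Function.comp_apply, ← Module.End.mul_apply, ← pow_add, add_comm]

/-- The module property of a conditional expectation: even powers of `Ψ` are multiplicative against
`a` and fix it, and this passes to the limit. -/
theorem apply_mul_of_fixed {σ : Matrix n n ℂ} (h : IsSymmUnitalCP Ψ σ) (hσ : σ.PosDef)
    {a : Matrix n n ℂ} (ha : Ψ (Ψ a) = a) (X : Matrix n n ℂ) : E (X * a) = E X * a := by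
  refine tendsto_nhds_unique (hE _) (((hE X).mul_const a).congr fun t => ?_)
  rw [h.pow_mul_of_fixed hσ ha, IsSymmUnitalCP.pow_two_mul_of_fixed ha]

theorem apply_conjTranspose {σ : Matrix n n ℂ} (h : IsSymmUnitalCP Ψ σ) (X : Matrix n n ℂ) :
    E Xᴴ = (E X)ᴴ := by
  refine tendsto_nhds_unique (hE _) (((hE X).star).congr fun t => ?_)
  rw [h.pow_conjTranspose]
  rfl

theorem posSemidef {σ : Matrix n n ℂ} (h : IsSymmUnitalCP Ψ σ) {X : Matrix n n ℂ}
    (hX : X.PosSemidef) : (E X).PosSemidef :=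
  posSemidef_of_tendsto (hE X) (Eventually.of_forall fun _ => h.pow_posSemidef _ hX)

theorem trace_apply {σ : Matrix n n ℂ} (h : IsSymmUnitalCP Ψ σ) (X : Matrix n n ℂ) :
    (E X * σ).trace = (X * σ).trace := by
  refine tendsto_nhds_unique
    (((by fun_prop : Continuous fun Y : Matrix n n ℂ => (Y * σ).trace).tendsto _).comp (hE X))
    (tendsto_const_nhds.congr fun t => ?_)
  exact (h.trace_pow _ X).symm

theorem apply_one {σ : Matrix n n ℂ} (h : IsSymmUnitalCP Ψ σ) : E 1 = 1 :=
  hE.apply_of_fixed (by rw [h.map_one, h.map_one])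

theorem mul_apply_of_fixed {σ : Matrix n n ℂ} (h : IsSymmUnitalCP Ψ σ) (hσ : σ.PosDef)
    {a : Matrix n n ℂ} (ha : Ψ (Ψ a) = a) (X : Matrix n n ℂ) : E (a * X) = a * E X := by
  have ha' : Ψ (Ψ aᴴ) = aᴴ := (h.fixedAlgebra hσ).star_mem' ha
  have := congrArg Matrix.conjTranspose (hE.apply_mul_of_fixed h hσ ha' Xᴴ)
  rwa [← hE.apply_conjTranspose h, Matrix.conjTranspose_mul, Matrix.conjTranspose_mul,
    ← hE.apply_conjTranspose h, Matrix.conjTranspose_conjTranspose,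
    Matrix.conjTranspose_conjTranspose] at this

end IsEvenLimit

end EvenLimit

/-! ### From an `L_2` estimate to an order estimate -/

section Comparison

variable {n : Type*} [Fintype n] [DecidableEq n]
  {Ψ E : Module.End ℂ (Matrix n n ℂ)} {σ : Matrix n n ℂ}

theorem IsSymmUnitalCP.mul_pow_of_fixed (h : IsSymmUnitalCP Ψ σ) (hσ : σ.PosDef)
    {a : Matrix n n ℂ} (ha : Ψ (Ψ a) = a) (t : ℕ) (X : Matrix n n ℂ) :
    (Ψ ^ t) (a * X) = (Ψ ^ t) a * (Ψ ^ t) X := by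
  have ha' : Ψ (Ψ aᴴ) = aᴴ := (h.fixedAlgebra hσ).star_mem' ha
  have := congrArg Matrix.conjTranspose (h.pow_mul_of_fixed hσ ha' t Xᴴ)
  rwa [← h.pow_conjTranspose, Matrix.conjTranspose_mul, Matrix.conjTranspose_mul,
    ← h.pow_conjTranspose, ← h.pow_conjTranspose, Matrix.conjTranspose_conjTranspose,
    Matrix.conjTranspose_conjTranspose] at this

variable (h : IsSymmUnitalCP Ψ σ) (hσ : σ.PosDef) (hE : IsEvenLimit Ψ E) {q Λ : ℝ}
  (hq : 0 < q) (hΛ : 0 < Λ) {t : ℕ}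
  (hT : ∀ X, (((Ψ ^ t) (X - E X))ᴴ * (Ψ ^ t) (X - E X) * σ).trace ≤
    ((q ^ 2 : ℝ) : ℂ) * (Xᴴ * X * σ).trace)
  (hindex : ∀ X : Matrix n n ℂ, X.PosSemidef → ((Λ : ℂ) • E X - X).PosSemidef)
include h hσ hE hq hΛ hT hindex

/-- The `L_2` bound becomes an operator bound by testing against elements `a` of the fixed algebra.
With `b = Ψ ^ t a`, multiplicativity gives `z a = Ψ ^ t (y b - E (y b))`, so the weight of `a E(z²)
a` is at most `q²` times that of `b y² b`. Now `y² ≤ Λ y` and `E y = 1` bound the latter by `Λ`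
times the weight of `a²`. -/
theorem posSemidef_condExp_sq {y : Matrix n n ℂ} (hy : y.PosSemidef) (hy1 : E y = 1) :
    (((q ^ 2 * Λ : ℝ) : ℂ) • (1 : Matrix n n ℂ) -
      E ((Ψ ^ t) (y - E y) * (Ψ ^ t) (y - E y))).PosSemidef := by
  set z := (Ψ ^ t) (y - E y) with hz
  have hzH : zᴴ = z := by
    rw [hz, ← h.pow_conjTranspose, Matrix.conjTranspose_sub, ← hE.apply_conjTranspose h, hy.1]
  have hfix : Ψ (Ψ (((q ^ 2 * Λ : ℝ) : ℂ) • (1 : Matrix n n ℂ) - E (z * z))) =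
      ((q ^ 2 * Λ : ℝ) : ℂ) • (1 : Matrix n n ℂ) - E (z * z) := by
    simp only [map_sub, map_smul, h.map_one, hE.map_map]
  have hzz : (z * z).PosSemidef := by
    simpa only [hzH] using Matrix.posSemidef_conjTranspose_mul_self z
  refine posSemidef_of_trace_cfc_nonneg hσ ?_ fun f => ?_
  · rw [Matrix.IsHermitian, Matrix.conjTranspose_sub, (hE.posSemidef h hzz).1]
    simp
  set a := cfc f (((q ^ 2 * Λ : ℝ) : ℂ) • (1 : Matrix n n ℂ) - E (z * z)) with ha
  have haH : aᴴ = a := cfc_conjTranspose _ _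
  have haf : Ψ (Ψ a) = a := h.cfc_fixed hσ hfix f
  set b := (Ψ ^ t) a with hb
  have hbf : Ψ (Ψ b) = b := IsSymmUnitalCP.pow_mem_of_fixed haf t
  have hbH : bᴴ = b := by rw [hb, ← h.pow_conjTranspose, haH]
  -- An even power of `Ψ` fixes `a`, so `Ψ ^ t` is its own inverse on the fixed algebra.
  have hba : (Ψ ^ t) b = a := by
    rw [hb, ← Module.End.mul_apply, ← pow_add, ← two_mul,
      IsSymmUnitalCP.pow_two_mul_of_fixed haf]
  have hza : (Ψ ^ t) (y * b - E (y * b)) = z * a := by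
    rw [hE.apply_mul_of_fixed h hσ hbf, ← Matrix.sub_mul, h.pow_mul_of_fixed hσ hbf, hba]
  have h1 := hT (y * b)
  rw [hza] at h1
  have h2 : ((z * a)ᴴ * (z * a) * σ).trace = (a * E (z * z) * a * σ).trace := by
    rw [← hE.mul_apply_of_fixed h hσ haf, ← hE.apply_mul_of_fixed h hσ haf, hE.trace_apply h,
      Matrix.conjTranspose_mul, haH, hzH]
    simp only [Matrix.mul_assoc]
  have h3 : ((y * b)ᴴ * (y * b) * σ).trace ≤ (Λ : ℂ) * (a * a * σ).trace := by
    have e1 : (a * a * σ).trace = (b * y * b * σ).trace := by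
      rw [← hE.trace_apply h (b * y * b), hE.apply_mul_of_fixed h hσ hbf,
        hE.mul_apply_of_fixed h hσ hbf, hy1, Matrix.mul_one, ← h.trace_pow t (b * b),
        h.pow_mul_of_fixed hσ hbf, hba]
    have hyΛ := hindex y hy
    rw [hy1] at hyΛ
    have hp := trace_mul_nonneg
      ((posSemidef_sub_sq hΛ hy hyΛ).conjTranspose_mul_mul_same b) hσ.posSemidef
    rw [hbH, Matrix.mul_sub, Matrix.sub_mul, Matrix.sub_mul, Matrix.trace_sub, sub_nonneg] at hp
    rw [e1, Matrix.conjTranspose_mul, hbH, hy.1]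
    simpa [Matrix.mul_assoc] using hp
  have hq2 : (0 : ℂ) ≤ ((q ^ 2 : ℝ) : ℂ) := by exact_mod_cast (sq_nonneg q)
  have h4 := h1.trans (mul_le_mul_of_nonneg_left h3 hq2)
  rw [h2] at h4
  rw [Matrix.mul_sub, Matrix.sub_mul, Matrix.sub_mul, Matrix.trace_sub, sub_nonneg]
  refine h4.trans (le_of_eq ?_)
  simp [mul_assoc]

theorem posSemidef_normalized {y : Matrix n n ℂ} (hy : y.PosSemidef) (hy1 : E y = 1) :
    ((Ψ ^ t) (y - E y) + ((Λ * q : ℝ) : ℂ) • 1).PosSemidef := by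
  have h1 := posSemidef_condExp_sq h hσ hE hq hΛ hT hindex hy hy1
  set z := (Ψ ^ t) (y - E y) with hz
  have hzH : zᴴ = z := by
    rw [hz, ← h.pow_conjTranspose, Matrix.conjTranspose_sub, ← hE.apply_conjTranspose h, hy.1]
  refine posSemidef_add_of_sq_le (by positivity) hzH ?_
  have hzz : (z * z).PosSemidef := by
    simpa only [hzH] using Matrix.posSemidef_conjTranspose_mul_self z
  -- This sum is `Λ (q² Λ - E(z²)) + (Λ E(z²) - z²) = (Λ q)² - z²`.
  have h2 := (posSemidef_smul h1 hΛ.le).add (hindex _ hzz)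
  convert h2 using 1
  simp only [smul_sub, smul_smul]
  push_cast
  module

/-- Normalize to `y = s X s` with `s = (E X)^{-1/2}`, so that `E y = 1`, then conjugate the estimate
back by `Ψ ^ t r` with `r = (E X)^{1/2}`. Both `r` and `s` lie in the fixed algebra, so `E` and `Ψ ^
t` respect these products. -/
theorem posSemidef_of_condExp_posDef {X : Matrix n n ℂ} (hX : X.PosSemidef)
    (hEX : (E X).PosDef) :
    ((Ψ ^ t) (X - E X) + ((Λ * q : ℝ) : ℂ) • (Ψ ^ t) (E X)).PosSemidef := by
  have hb : IsSelfAdjoint (E X) := hEX.1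
  have hid : cfc (fun x : ℝ => x) (E X) = E X := cfc_id' ℝ (E X)
  set r := cfc (fun x : ℝ => √x) (E X) with hr
  set s := cfc (fun x : ℝ => (√x)⁻¹) (E X) with hs
  have hrf : Ψ (Ψ r) = r := h.cfc_fixed hσ (hE.map_map X) _
  have hsf : Ψ (Ψ s) = s := h.cfc_fixed hσ (hE.map_map X) _
  have hrH : rᴴ = r := cfc_conjTranspose _ _
  have hsH : sᴴ = s := cfc_conjTranspose _ _
  have hone : cfc (fun _ : ℝ => 1) (E X) = 1 := cfc_const_one ℝ (E X)
  have hrs : r * s = 1 := by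
    rw [hr, hs, cfc_mul_cfc, ← hone]
    exact cfc_congr fun x hx =>
      mul_inv_cancel₀ (Real.sqrt_pos.mpr (spectrum_pos_of_posDef hEX hx)).ne'
  have hsr : s * r = 1 := mul_eq_one_comm.mp hrs
  have hrr : r * r = E X := by
    rw [hr, cfc_mul_cfc]
    conv_rhs => rw [← hid]
    exact cfc_congr fun x hx => Real.mul_self_sqrt (spectrum_pos_of_posDef hEX hx).le
  have hy : (s * X * s).PosSemidef := by
    simpa only [hsH] using hX.conjTranspose_mul_mul_same s
  have hy1 : E (s * X * s) = 1 := by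
    rw [hE.apply_mul_of_fixed h hσ hsf, hE.mul_apply_of_fixed h hσ hsf, ← hrr,
      ← Matrix.mul_assoc, hsr, Matrix.one_mul, hrs]
  have hX' : X = r * (s * X * s) * r := by
    rw [Matrix.mul_assoc, Matrix.mul_assoc, hsr, Matrix.mul_one, ← Matrix.mul_assoc, hrs,
      Matrix.one_mul]
  have key := (posSemidef_normalized h hσ hE hq hΛ hT hindex hy hy1).conjTranspose_mul_mul_same
    ((Ψ ^ t) r)
  rw [← h.pow_conjTranspose, hrH, hy1] at key
  convert key using 1
  rw [Matrix.mul_add, Matrix.add_mul, ← h.mul_pow_of_fixed hσ hrf, ← h.pow_mul_of_fixed hσ hrf,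
    Matrix.mul_sub, Matrix.sub_mul, ← hX', Matrix.mul_one, hrr, Matrix.mul_smul, Matrix.mul_one,
    Matrix.smul_mul, ← h.pow_mul_of_fixed hσ hrf, hrr]

/-- An `L₂`-estimate for `Ψ ^ t ∘ (id - E)` and a Pimsner-Popa inequality for `E` give an order
estimate. -/
theorem posSemidef_pow_sub_smul {X : Matrix n n ℂ} (hX : X.PosSemidef) :
    ((Ψ ^ t) X - ((1 - Λ * q : ℝ) : ℂ) • (Ψ ^ t) (E X)).PosSemidef := by
  -- Replacing `X` by `X + δ` makes `E X` invertible; the error disappears as `δ → 0`.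
  have hδ : ∀ δ : ℝ, 0 < δ → ((Ψ ^ t) X - ((1 - Λ * q : ℝ) : ℂ) • (Ψ ^ t) (E X) +
      ((Λ * q * δ : ℝ) : ℂ) • (1 : Matrix n n ℂ)).PosSemidef := fun δ hδ => by
    have hδ1 : ((δ : ℂ) • (1 : Matrix n n ℂ)).PosDef :=
      Matrix.PosDef.one.smul (by exact_mod_cast hδ)
    have hE1 : E (X + (δ : ℂ) • 1) = E X + (δ : ℂ) • 1 := by
      rw [map_add, map_smul, hE.apply_one h]
    have hpow1 : (Ψ ^ t) 1 = 1 := by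
      clear hT
      induction t with
      | zero => rfl
      | succ t ih => rw [pow_succ, Module.End.mul_apply, h.map_one, ih]
    have := posSemidef_of_condExp_posDef h hσ hE hq hΛ hT hindex (hX.add hδ1.posSemidef)
      (by rw [hE1]; exact Matrix.PosDef.posSemidef_add (hE.posSemidef h hX) hδ1)
    convert this using 1
    rw [hE1, add_sub_add_right_eq_sub, map_sub, map_add, map_smul, hpow1]
    push_cast
    module
  have hlim : Tendsto (fun k : ℕ => (Ψ ^ t) X - ((1 - Λ * q : ℝ) : ℂ) • (Ψ ^ t) (E X) +
      ((Λ * q * (1 / ((k : ℝ) + 1)) : ℝ) : ℂ) • (1 : Matrix n n ℂ)) atTop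
      (𝓝 ((Ψ ^ t) X - ((1 - Λ * q : ℝ) : ℂ) • (Ψ ^ t) (E X) +
        ((Λ * q * 0 : ℝ) : ℂ) • (1 : Matrix n n ℂ))) := by
    refine Tendsto.const_add _ (Tendsto.smul_const ?_ _)
    exact (Complex.continuous_ofReal.tendsto _).comp
      (tendsto_one_div_add_atTop_nhds_zero_nat.const_mul _)
  simp only [mul_zero, Complex.ofReal_zero, zero_smul, add_zero] at hlim
  exact posSemidef_of_tendsto hlim (Eventually.of_forall fun k => hδ _ (by positivity))

end Comparison

/-! ### Fidelities bounded by the trace scaling factor -/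

section Fidelity

variable {d : ℕ}

theorem classicalFidelity_sub_smul (S T : Module.End ℂ (Matrix (Fin d) (Fin d) ℂ)) (c : ℝ) :
    classicalFidelity (S - (c : ℂ) • T) = classicalFidelity S - c * classicalFidelity T := by
  simp only [classicalFidelity, LinearMap.sub_apply, LinearMap.smul_apply, Matrix.sub_apply,
    Matrix.smul_apply, smul_eq_mul, Complex.sub_re, Complex.re_ofReal_mul,
    Finset.sum_sub_distrib, ← Finset.mul_sum]
  ring

theorem entanglementFidelity_sub_smul (S T : Module.End ℂ (Matrix (Fin d) (Fin d) ℂ)) (c : ℝ) :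
    entanglementFidelity (S - (c : ℂ) • T) =
      entanglementFidelity S - c * entanglementFidelity T := by
  simp only [entanglementFidelity, ampliation_sub, ampliation_smul, LinearMap.sub_apply,
    LinearMap.smul_apply, Matrix.sub_mulVec, Matrix.smul_mulVec, dotProduct_sub, dotProduct_smul,
    smul_eq_mul, Complex.sub_re, Complex.re_ofReal_mul]

theorem classicalFidelity_le (hd : 1 ≤ d) {R : Module.End ℂ (Matrix (Fin d) (Fin d) ℂ)}
    (hR : IsCP R) {r : ℝ} (hr : ∀ X, (R X).trace = r * X.trace) : classicalFidelity R ≤ r := by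
  have h : ∀ i, (R (Matrix.single i i 1) i i).re ≤ r := fun i => by
    have hp : (Matrix.single i i (1 : ℂ)).PosSemidef := by
      have := Matrix.posSemidef_vecMulVec_self_star (Pi.single i (1 : ℂ))
      rwa [Pi.star_single, star_one, ← Matrix.single_eq_single_vecMulVec_single] at this
    have hq := hR.posSemidef hp
    have htr : (R (Matrix.single i i 1)).trace.re = r := by
      rw [hr, Matrix.trace_single_eq_same]
      simp
    rw [← htr, Matrix.trace, Complex.re_sum]
    refine Finset.single_le_sum (f := fun j => (R (Matrix.single i i 1) j j).re)
      (fun j _ => ?_) (Finset.mem_univ i)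
    exact (Complex.nonneg_iff.mp (hq.diag_nonneg (i := j))).1
  have hd0 : (0 : ℝ) < d := by exact_mod_cast hd
  rw [classicalFidelity]
  calc (1 / (d : ℝ)) * ∑ i, (R (Matrix.single i i 1) i i).re
      ≤ (1 / (d : ℝ)) * ∑ _i : Fin d, r :=
        mul_le_mul_of_nonneg_left (Finset.sum_le_sum fun i _ => h i) (by positivity)
    _ = r := by simp; field_simp

theorem trace_ampliation {m n : Type*} [Fintype m] [Fintype n] (k : ℕ)
    {Φ : Matrix m m ℂ →ₗ[ℂ] Matrix n n ℂ} {r : ℂ} (h : ∀ X, (Φ X).trace = r * X.trace)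
    (X : Matrix (Fin k × m) (Fin k × m) ℂ) : (ampliation k Φ X).trace = r * X.trace := by
  simp only [Matrix.trace, Matrix.diag, ampliation_apply, Fintype.sum_prod_type,
    Finset.mul_sum]
  refine Finset.sum_congr rfl fun a _ => ?_
  rw [← Finset.mul_sum]
  exact h (Matrix.of fun i j => X (a, i) (a, j))

theorem maxEntangled_dotProduct (hd : 1 ≤ d) :
    star (maxEntangled d) ⬝ᵥ maxEntangled d = 1 := by
  have hd0 : (0 : ℝ) < d := by exact_mod_cast hd
  have hs : ((√d : ℝ) : ℂ) * ((√d : ℝ) : ℂ) = d := by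
    rw [← Complex.ofReal_mul, Real.mul_self_sqrt hd0.le, Complex.ofReal_natCast]
  have hs0 : ((√d : ℝ) : ℂ) ≠ 0 := by exact_mod_cast (Real.sqrt_pos.mpr hd0).ne'
  simp [dotProduct, Fintype.sum_prod_type, maxEntangled, apply_ite (starRingEnd ℂ)]
  rw [← hs]
  field_simp

/-- The matrix `1 - v v*` is a projection, so it pairs nonnegatively with `ρ`. -/
theorem dotProduct_mulVec_le_trace {n : Type*} [Fintype n] {ρ : Matrix n n ℂ}
    (hρ : ρ.PosSemidef) {v : n → ℂ} (hv : star v ⬝ᵥ v = 1) : star v ⬝ᵥ (ρ *ᵥ v) ≤ ρ.trace := by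
  classical
  have hQ : (1 - Matrix.vecMulVec v (star v)).PosSemidef := by
    have := Matrix.posSemidef_conjTranspose_mul_self (1 - Matrix.vecMulVec v (star v))
    convert this using 1
    have hvv : Matrix.vecMulVec v (star v) * Matrix.vecMulVec v (star v) =
        Matrix.vecMulVec v (star v) := by
      rw [Matrix.vecMulVec_mul_vecMulVec, hv]
      simp
    rw [Matrix.conjTranspose_sub, Matrix.conjTranspose_one, Matrix.conjTranspose_vecMulVec,
      star_star, Matrix.mul_sub, Matrix.sub_mul, Matrix.sub_mul, hvv]
    simp
  have := trace_mul_nonneg hρ hQ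
  rwa [Matrix.mul_sub, Matrix.mul_one, Matrix.trace_sub, trace_mul_vecMulVec, sub_nonneg] at this

theorem entanglementFidelity_le (hd : 1 ≤ d) {R : Module.End ℂ (Matrix (Fin d) (Fin d) ℂ)}
    (hR : IsCP R) {r : ℝ} (hr : ∀ X, (R X).trace = r * X.trace) :
    entanglementFidelity R ≤ r := by
  have hv := maxEntangled_dotProduct hd
  have h := dotProduct_mulVec_le_trace
    (hR d _ (Matrix.posSemidef_vecMulVec_self_star (maxEntangled d))) hv
  rw [trace_ampliation d hr, Matrix.trace_vecMulVec, dotProduct_comm (maxEntangled d), hv,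
    mul_one] at h
  exact (Complex.le_def.mp h).1.trans_eq (Complex.ofReal_re r)

end Fidelity

/-! ### Transfer of zero-error codes between channels -/

section Codes

variable {m : Type*} [Fintype m] {d : ℕ}

theorem IsClassicalCode.of_factorization {A B D' E' : Module.End ℂ (Matrix m m ℂ)}
    (hD' : IsChannel D') (hE' : IsChannel E') (hB : B = D' * A * E') {δ : ℝ}
    {E : Matrix (Fin d) (Fin d) ℂ →ₗ[ℂ] Matrix m m ℂ} (h : IsClassicalCode B d δ E) :
    IsClassicalCode A d δ (E' ∘ₗ E) := by
  obtain ⟨hE, D, hD, hF⟩ := h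
  subst hB
  exact ⟨hE'.comp hE, D ∘ₗ D', hD.comp hD', hF⟩

theorem IsQuantumCode.of_factorization {A B D' E' : Module.End ℂ (Matrix m m ℂ)}
    (hD' : IsChannel D') (hE' : IsChannel E') (hB : B = D' * A * E') {δ : ℝ}
    {E : Matrix (Fin d) (Fin d) ℂ →ₗ[ℂ] Matrix m m ℂ} (h : IsQuantumCode B d δ E) :
    IsQuantumCode A d δ (E' ∘ₗ E) := by
  obtain ⟨hE, D, hD, hF⟩ := h
  subst hB
  exact ⟨hE'.comp hE, D ∘ₗ D', hD.comp hD', hF⟩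

theorem isCP_comp_sub_smul {A B : Module.End ℂ (Matrix m m ℂ)} {c : ℝ}
    (hAB : IsCP (A - (c : ℂ) • B)) {E : Matrix (Fin d) (Fin d) ℂ →ₗ[ℂ] Matrix m m ℂ}
    {D : Matrix m m ℂ →ₗ[ℂ] Matrix (Fin d) (Fin d) ℂ} (hE : IsCP E) (hD : IsCP D) :
    IsCP (D ∘ₗ A ∘ₗ E - (c : ℂ) • (D ∘ₗ B ∘ₗ E)) := by
  have := hD.comp (hAB.comp hE)
  rwa [LinearMap.sub_comp, LinearMap.comp_sub, LinearMap.smul_comp, LinearMap.comp_smul] at this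

theorem trace_sub_smul {S T : Module.End ℂ (Matrix (Fin d) (Fin d) ℂ)} (hS : IsChannel S)
    (hT : IsChannel T) (c : ℝ) (X : Matrix (Fin d) (Fin d) ℂ) :
    ((S - (c : ℂ) • T) X).trace = ((1 - c : ℝ) : ℂ) * X.trace := by
  simp only [LinearMap.sub_apply, LinearMap.smul_apply, Matrix.trace_sub, Matrix.trace_smul,
    hS.tracePreserving, hT.tracePreserving, smul_eq_mul]
  push_cast
  ring

/-- A perfect code for `A` is a perfect code for every channel dominated by a multiple of `A`. -/
theorem IsClassicalCode.of_isCP_sub {A B : Module.End ℂ (Matrix m m ℂ)} (hA : IsChannel A)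
    (hB : IsChannel B) {c : ℝ} (hc : 0 < c) (hAB : IsCP (A - (c : ℂ) • B)) (hd : 1 ≤ d)
    {E : Matrix (Fin d) (Fin d) ℂ →ₗ[ℂ] Matrix m m ℂ} (h : IsClassicalCode A d 0 E) :
    IsClassicalCode B d 0 E := by
  obtain ⟨hE, D, hD, hF⟩ := h
  refine ⟨hE, D, hD, ?_⟩
  -- The difference scales the trace by `1 - c`, so `F(A) - c F(B) ≤ 1 - c`; with `F(A) ≥ 1` and `c
  -- > 0` this gives `F(B) ≥ 1`.
  have h1 := classicalFidelity_le hd (isCP_comp_sub_smul hAB hE.isCP hD.isCP)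
    (trace_sub_smul (hD.comp (hA.comp hE)) (hD.comp (hB.comp hE)) c)
  rw [classicalFidelity_sub_smul] at h1
  nlinarith

theorem IsQuantumCode.of_isCP_sub {A B : Module.End ℂ (Matrix m m ℂ)} (hA : IsChannel A)
    (hB : IsChannel B) {c : ℝ} (hc : 0 < c) (hAB : IsCP (A - (c : ℂ) • B)) (hd : 1 ≤ d)
    {E : Matrix (Fin d) (Fin d) ℂ →ₗ[ℂ] Matrix m m ℂ} (h : IsQuantumCode A d 0 E) :
    IsQuantumCode B d 0 E := by
  obtain ⟨hE, D, hD, hF⟩ := h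
  refine ⟨hE, D, hD, ?_⟩
  have h1 := entanglementFidelity_le hd (isCP_comp_sub_smul hAB hE.isCP hD.isCP)
    (trace_sub_smul (hD.comp (hA.comp hE)) (hD.comp (hB.comp hE)) c)
  rw [entanglementFidelity_sub_smul] at h1
  nlinarith

theorem classicalCapacity_mono {A B : Module.End ℂ (Matrix m m ℂ)} {δ : ℝ}
    (h : ∀ d, 1 ≤ d → ∀ E, IsClassicalCode A d δ E → ∃ E', IsClassicalCode B d δ E') :
    classicalCapacity δ A ≤ classicalCapacity δ B :=
  iSup_mono fun d => iSup_mono fun hd => iSup_le fun ⟨E, hE⟩ =>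
    le_iSup_of_le (h d hd E hE) le_rfl

theorem quantumCapacity_mono {A B : Module.End ℂ (Matrix m m ℂ)} {δ : ℝ}
    (h : ∀ d, 1 ≤ d → ∀ E, IsQuantumCode A d δ E → ∃ E', IsQuantumCode B d δ E') :
    quantumCapacity δ A ≤ quantumCapacity δ B :=
  iSup_mono fun d => iSup_mono fun hd => iSup_le fun ⟨E, hE⟩ =>
    le_iSup_of_le (h d hd E hE) le_rfl

/-- If `P` factors through `A` and `A` dominates a multiple of a channel `B` that factors through
`P`, then `A` and `P` have the same zero-error capacities. -/
theorem capacities_eq {A B P D₁ E₁ D₂ E₂ : Module.End ℂ (Matrix m m ℂ)} (hA : IsChannel A)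
    (hB : IsChannel B) (hD₁ : IsChannel D₁) (hE₁ : IsChannel E₁) (hD₂ : IsChannel D₂)
    (hE₂ : IsChannel E₂) (hP : P = D₁ * A * E₁) (hBP : B = D₂ * P * E₂) {c : ℝ} (hc : 0 < c)
    (hAB : IsCP (A - (c : ℂ) • B)) :
    classicalCapacity 0 A = classicalCapacity 0 P ∧ quantumCapacity 0 A = quantumCapacity 0 P := by
  refine ⟨le_antisymm (classicalCapacity_mono fun d hd E hE => ?_)
    (classicalCapacity_mono fun d hd E hE => ?_), le_antisymm
    (quantumCapacity_mono fun d hd E hE => ?_) (quantumCapacity_mono fun d hd E hE => ?_)⟩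
  · exact ⟨_, (hE.of_isCP_sub hA hB hc hAB hd).of_factorization hD₂ hE₂ hBP⟩
  · exact ⟨_, hE.of_factorization hD₁ hE₁ hP⟩
  · exact ⟨_, (hE.of_isCP_sub hA hB hc hAB hd).of_factorization hD₂ hE₂ hBP⟩
  · exact ⟨_, hE.of_factorization hD₁ hE₁ hP⟩

end Codes

/-! ### Pimsner-Popa constants -/

section PimsnerPopa

variable {m : Type*} [Fintype m]

/-- The infimum is attained because the positive cone is closed. An admissible constant can be
enlarged, since `X ≤ C' P(X)` already forces `P(X) ≥ 0`. -/
theorem posSemidef_of_pimsnerPopa_le {P : Module.End ℂ (Matrix m m ℂ)} {C : ℝ≥0}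
    (h : pimsnerPopa P ≤ C) {X : Matrix m m ℂ} (hX : X.PosSemidef) :
    (((C : ℝ) : ℂ) • P X - X).PosSemidef := by
  have hC : ∀ δ : ℝ≥0, 0 < δ → ((((C + δ : ℝ≥0) : ℝ) : ℂ) • P X - X).PosSemidef := fun δ hδ => by
    have hlt : pimsnerPopa P < ((C + δ : ℝ≥0) : ℝ≥0∞) :=
      h.trans_lt (by exact_mod_cast lt_add_of_pos_right C hδ)
    simp only [pimsnerPopa, iInf_lt_iff] at hlt
    obtain ⟨C', hC', hX', hlt⟩ := hlt
    have h1 := hX' X hX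
    have hPX : (P X).PosSemidef := by
      have := posSemidef_smul (h1.add hX) (c := (C' : ℝ)⁻¹) (by positivity)
      rwa [sub_add_cancel, smul_smul, ← Complex.ofReal_mul,
        inv_mul_cancel₀ (by exact_mod_cast hC'.ne'), Complex.ofReal_one, one_smul] at this
    have hle : (C' : ℝ) ≤ ((C + δ : ℝ≥0) : ℝ) := by
      exact_mod_cast (ENNReal.coe_lt_coe.mp hlt).le
    convert h1.add (posSemidef_smul hPX (sub_nonneg.mpr hle)) using 1
    push_cast
    module
  have hlim : Tendsto (fun k : ℕ => (((C : ℝ) + 1 / ((k : ℝ) + 1) : ℝ) : ℂ) • P X - X) atTop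
      (𝓝 ((((C : ℝ) + 0 : ℝ) : ℂ) • P X - X)) := by
    refine Tendsto.sub_const (Tendsto.smul_const ?_ _) _
    exact (Complex.continuous_ofReal.tendsto _).comp
      (tendsto_one_div_add_atTop_nhds_zero_nat.const_add _)
  rw [add_zero] at hlim
  refine posSemidef_of_tendsto hlim (Eventually.of_forall fun k => ?_)
  simpa using hC (1 / ((k : ℝ≥0) + 1)) (by positivity)

theorem isCP_of_completePimsnerPopa_le {P : Module.End ℂ (Matrix m m ℂ)} {C : ℝ≥0}
    (h : completePimsnerPopa P ≤ C) : IsCP (((C : ℝ) : ℂ) • P - 1) := fun k _ hX =>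
  posSemidef_of_pimsnerPopa_le ((le_iSup (fun k => pimsnerPopa (ampliation k P)) k).trans h) hX

theorem completePimsnerPopa_le {P : Module.End ℂ (Matrix m m ℂ)} {C : ℝ≥0} (hC : 0 < C)
    (h : IsCP (((C : ℝ) : ℂ) • P - 1)) : completePimsnerPopa P ≤ C :=
  iSup_le fun k => iInf_le_of_le C (iInf_le_of_le hC (iInf_le_of_le (h k) le_rfl))

/-- Compare traces at the identity matrix, whose trace is positive. -/
theorem one_le_of_isCP [Nonempty m] {P : Module.End ℂ (Matrix m m ℂ)} (hP : IsChannel P)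
    {C : ℝ≥0} (h : IsCP (((C : ℝ) : ℂ) • P - 1)) : 1 ≤ C := by
  classical
  have h1 := (h.posSemidef (Matrix.PosSemidef.one (n := m))).trace_nonneg
  simp only [LinearMap.sub_apply, LinearMap.smul_apply, Module.End.one_apply, Matrix.trace_sub,
    Matrix.trace_smul, hP.tracePreserving, Matrix.trace_one, smul_eq_mul] at h1
  have h2 : (0 : ℝ) ≤ C * Fintype.card m - Fintype.card m := by exact_mod_cast h1
  have h3 : (0 : ℝ) < Fintype.card m := by exact_mod_cast Fintype.card_pos
  have h4 : (1 : ℝ) ≤ C := by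
    by_contra! hlt
    nlinarith
  exact_mod_cast h4

theorem one_le_completePimsnerPopa [Nonempty m] {P : Module.End ℂ (Matrix m m ℂ)}
    (hP : IsChannel P) : 1 ≤ completePimsnerPopa P := by
  rcases eq_or_ne (completePimsnerPopa P) ⊤ with h | h
  · simp [h]
  · rw [← ENNReal.coe_toNNReal h]
    exact_mod_cast one_le_of_isCP hP (isCP_of_completePimsnerPopa_le (ENNReal.coe_toNNReal h).ge)

end PimsnerPopa

/-! ### The norm of `L_2(σ)` and its operator norm -/

section GNSNorm

variable {n : Type*} [Fintype n]

theorem gnsNorm_nonneg (σ X : Matrix n n ℂ) : 0 ≤ gnsNorm σ X := Real.sqrt_nonneg _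

theorem trace_eq_gnsNorm_sq {σ : Matrix n n ℂ} (hσ : σ.PosDef) (X : Matrix n n ℂ) :
    (Xᴴ * X * σ).trace = ((gnsNorm σ X ^ 2 : ℝ) : ℂ) := by
  have h := Complex.nonneg_iff.mp
    (trace_mul_nonneg (Matrix.posSemidef_conjTranspose_mul_self X) hσ.posSemidef)
  rw [gnsNorm, Real.sq_sqrt h.1]
  exact Complex.ext rfl h.2.symm

theorem eq_zero_of_gnsNorm_eq_zero {σ : Matrix n n ℂ} (hσ : σ.PosDef) {X : Matrix n n ℂ}
    (h : gnsNorm σ X = 0) : X = 0 :=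
  eq_zero_of_trace_mul_eq_zero hσ (by rw [trace_eq_gnsNorm_sq hσ, h]; simp)

theorem gnsNorm_le_of_gnsOpNorm_le {σ : Matrix n n ℂ} {T : Module.End ℂ (Matrix n n ℂ)} {C : ℝ≥0}
    (h : gnsOpNorm σ T ≤ C) (X : Matrix n n ℂ) : gnsNorm σ (T X) ≤ C * gnsNorm σ X := by
  have hδ : ∀ δ : ℝ≥0, 0 < δ → gnsNorm σ (T X) ≤ ((C + δ : ℝ≥0) : ℝ) * gnsNorm σ X :=
    fun δ hδ => by
      have hlt : gnsOpNorm σ T < ((C + δ : ℝ≥0) : ℝ≥0∞) :=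
        h.trans_lt (by exact_mod_cast lt_add_of_pos_right C hδ)
      simp only [gnsOpNorm, iInf_lt_iff] at hlt
      obtain ⟨C', hC', hlt⟩ := hlt
      refine (hC' X).trans (mul_le_mul_of_nonneg_right ?_ (gnsNorm_nonneg σ X))
      exact_mod_cast (ENNReal.coe_lt_coe.mp hlt).le
  have hlim : Tendsto (fun k : ℕ => ((C : ℝ) + 1 / ((k : ℝ) + 1)) * gnsNorm σ X) atTop
      (𝓝 (((C : ℝ) + 0) * gnsNorm σ X)) :=
    (tendsto_one_div_add_atTop_nhds_zero_nat.const_add _).mul_const _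
  rw [add_zero] at hlim
  refine ge_of_tendsto' hlim fun k => ?_
  simpa using hδ (1 / ((k : ℝ≥0) + 1)) (by positivity)

theorem gnsOpNorm_le {σ : Matrix n n ℂ} {T : Module.End ℂ (Matrix n n ℂ)} {C : ℝ≥0}
    (h : ∀ X, gnsNorm σ (T X) ≤ C * gnsNorm σ X) : gnsOpNorm σ T ≤ C :=
  iInf_le_of_le C (iInf_le_of_le h le_rfl)

end GNSNorm

/-! ### Operators diagonal in an orthonormal basis of `L_2(σ)` -/

section OrthonormalBasis

variable {n κ : Type*} [Fintype n] [Fintype κ] [DecidableEq κ]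

/-- `b` is an orthonormal basis of `L_2(σ)`. -/
structure IsGNSBasis (σ : Matrix n n ℂ) (b : κ → Matrix n n ℂ) : Prop where
  orthonormal : ∀ i j, ((b i)ᴴ * b j * σ).trace = if i = j then 1 else 0
  exists_eq_sum : ∀ X, ∃ c : κ → ℂ, X = ∑ i, c i • b i

theorem IsGNSBasis.gnsNorm_sum {σ : Matrix n n ℂ} {b : κ → Matrix n n ℂ} (hb : IsGNSBasis σ b)
    (c : κ → ℂ) : gnsNorm σ (∑ i, c i • b i) = √(∑ i, ‖c i‖ ^ 2) := by
  have h : ((∑ i, c i • b i)ᴴ * (∑ i, c i • b i) * σ).trace = ((∑ i, ‖c i‖ ^ 2 : ℝ) : ℂ) := by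
    simp only [Matrix.conjTranspose_sum, Matrix.conjTranspose_smul, Finset.sum_mul,
      Finset.mul_sum, Matrix.smul_mul, Matrix.mul_smul, Matrix.trace_sum, Matrix.trace_smul,
      hb.orthonormal, smul_eq_mul, mul_ite, mul_one, mul_zero]
    push_cast
    simp [Complex.mul_conj']
  rw [gnsNorm, h, Complex.ofReal_re]

theorem IsGNSBasis.eq_sum {σ : Matrix n n ℂ} {b : κ → Matrix n n ℂ} (hb : IsGNSBasis σ b)
    (X : Matrix n n ℂ) : X = ∑ i, ((b i)ᴴ * X * σ).trace • b i := by
  obtain ⟨c, rfl⟩ := hb.exists_eq_sum X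
  refine Finset.sum_congr rfl fun i _ => ?_
  congr 1
  simp [Matrix.mul_sum, Matrix.sum_mul, Matrix.trace_sum, hb.orthonormal]

/-- The operator norm of an operator that is diagonal in an orthonormal basis of `L_2(σ)`. -/
theorem IsGNSBasis.forall_gnsNorm_le_iff {σ : Matrix n n ℂ} {b : κ → Matrix n n ℂ}
    (hb : IsGNSBasis σ b) {T : Module.End ℂ (Matrix n n ℂ)} {τ : κ → ℝ}
    (hT : ∀ i, T (b i) = (τ i : ℂ) • b i) (C : ℝ≥0) :
    (∀ X, gnsNorm σ (T X) ≤ C * gnsNorm σ X) ↔ ∀ i, |τ i| ≤ C := by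
  constructor
  · intro h i
    have hi : ∀ z : ℂ, gnsNorm σ (z • b i) = ‖z‖ := fun z => by
      have := hb.gnsNorm_sum (Pi.single i z)
      rw [Finset.sum_eq_single i (by intro j _ hj; simp [hj]) (by simp),
        Finset.sum_eq_single i (by intro j _ hj; simp [hj]) (by simp)] at this
      simpa using this
    have h1 := h (b i)
    rw [hT, hi] at h1
    have h2 := hi 1
    rw [one_smul] at h2
    rw [h2] at h1
    simpa using h1
  · intro h X
    obtain ⟨c, rfl⟩ := hb.exists_eq_sum X
    have hTX : T (∑ i, c i • b i) = ∑ i, (c i * τ i) • b i := by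
      simp only [map_sum, map_smul, hT, smul_smul]
    rw [hTX, hb.gnsNorm_sum, hb.gnsNorm_sum]
    have hC : (C : ℝ) = √((C : ℝ) ^ 2) := (Real.sqrt_sq C.2).symm
    rw [hC, ← Real.sqrt_mul (sq_nonneg _), Finset.mul_sum]
    refine Real.sqrt_le_sqrt (Finset.sum_le_sum fun i _ => ?_)
    rw [norm_mul, mul_pow, mul_comm, Complex.norm_real, Real.norm_eq_abs]
    exact mul_le_mul_of_nonneg_right (pow_le_pow_left₀ (abs_nonneg _) (h i) 2) (sq_nonneg _)

end OrthonormalBasis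

/-! ### Spectral decomposition and existence of the limit -/

section Spectral

variable {n : Type*} [Fintype n] [DecidableEq n]

theorem IsSymmUnitalCP.exists_eigenbasis {Ψ : Module.End ℂ (Matrix n n ℂ)} {σ : Matrix n n ℂ}
    (h : IsSymmUnitalCP Ψ σ) (hσ : σ.PosDef) :
    ∃ (b : Fin (Module.finrank ℂ (Matrix n n ℂ)) → Matrix n n ℂ)
      (μ : Fin (Module.finrank ℂ (Matrix n n ℂ)) → ℝ),
      IsGNSBasis σ b ∧ (∀ i, Ψ (b i) = (μ i : ℂ) • b i) ∧ ∀ i, |μ i| ≤ 1 := by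
  let _ : NormedAddCommGroup (Matrix n n ℂ) := σ.toMatrixNormedAddCommGroup hσ
  let _ : InnerProductSpace ℂ (Matrix n n ℂ) := σ.toMatrixInnerProductSpace hσ.posSemidef
  have hinner : ∀ X Y : Matrix n n ℂ, inner ℂ X Y = (Xᴴ * Y * σ).trace := fun X Y => by
    rw [Matrix.mul_assoc, Matrix.trace_mul_comm]
    rfl
  have hsymm : Ψ.IsSymmetric := fun X Y => by
    rw [hinner, hinner, h.symm, h.isCP.map_conjTranspose]
  let B := hsymm.eigenvectorBasis rfl
  have hB : IsGNSBasis σ B := by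
    refine ⟨fun i j => ?_, fun X => ⟨fun i => B.repr X i, (B.sum_repr X).symm⟩⟩
    rw [← hinner]
    exact (orthonormal_iff_ite.mp B.orthonormal) i j
  have hΨ : ∀ i, Ψ (B i) = ((hsymm.eigenvalues rfl i : ℝ) : ℂ) • B i :=
    fun i => hsymm.apply_eigenvectorBasis rfl i
  refine ⟨B, hsymm.eigenvalues rfl, hB, hΨ, ?_⟩
  -- The bound on the eigenvalues is the `L_2` contractivity given by Kadison-Schwarz.
  refine (hB.forall_gnsNorm_le_iff hΨ 1).mp fun X => ?_
  rw [NNReal.coe_one, one_mul]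
  refine Real.sqrt_le_sqrt ?_
  exact (Complex.le_def.mp (h.trace_map_le hσ X)).1

/-- The linear functional `X ↦ tr (Aᴴ X σ)`. -/
def gnsFunctional (σ A : Matrix n n ℂ) : Matrix n n ℂ →ₗ[ℂ] ℂ where
  toFun X := (Aᴴ * X * σ).trace
  map_add' X Y := by simp [Matrix.mul_add, Matrix.add_mul]
  map_smul' c X := by simp

theorem exists_isEvenLimit {κ : Type*} [Fintype κ] [DecidableEq κ]
    {Ψ : Module.End ℂ (Matrix n n ℂ)} {σ : Matrix n n ℂ} {b : κ → Matrix n n ℂ} {μ : κ → ℝ}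
    (hb : IsGNSBasis σ b) (hΨ : ∀ i, Ψ (b i) = (μ i : ℂ) • b i) (hμ : ∀ i, |μ i| ≤ 1) :
    ∃ E, IsEvenLimit Ψ E := by
  refine ⟨∑ i, (if |μ i| = 1 then (1 : ℂ) else 0) • (gnsFunctional σ (b i)).smulRight (b i),
    fun X => ?_⟩
  have hpow : ∀ (t : ℕ) i, (Ψ ^ t) (b i) = ((μ i ^ t : ℝ) : ℂ) • b i := fun t i => by
    induction t with
    | zero => simp
    | succ t ih =>
      rw [pow_succ', Module.End.mul_apply, ih, map_smul, hΨ, smul_smul, ← Complex.ofReal_mul,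
        ← pow_succ]
  have hX : ∀ t : ℕ, (Ψ ^ (2 * t)) X =
      ∑ i, (((μ i ^ (2 * t) : ℝ) : ℂ)) • ((gnsFunctional σ (b i)) X • b i) := fun t => by
    conv_lhs => rw [hb.eq_sum X]
    simp only [map_sum, map_smul, hpow]
    refine Finset.sum_congr rfl fun i _ => ?_
    rw [smul_comm]
    rfl
  simp only [hX, LinearMap.sum_apply, LinearMap.smul_apply, LinearMap.smulRight_apply]
  refine tendsto_finsetSum _ fun i _ => Tendsto.smul_const ?_ _
  have hlim : Tendsto (fun t : ℕ => μ i ^ (2 * t)) atTop (𝓝 (if |μ i| = 1 then 1 else 0)) := by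
    simp only [pow_mul]
    split_ifs with h1
    · have : μ i ^ 2 = 1 := by rw [← sq_abs, h1, one_pow]
      simp [this]
    · refine tendsto_pow_atTop_nhds_zero_of_lt_one (sq_nonneg _) ?_
      rw [← sq_abs]
      exact pow_lt_one₀ (abs_nonneg _) (lt_of_le_of_ne (hμ i) h1) two_ne_zero
  have := (Complex.continuous_ofReal.tendsto _).comp hlim
  split_ifs at this ⊢ <;> simpa [Function.comp_def] using this

theorem IsEvenLimit.apply_eigenvector {Ψ E : Module.End ℂ (Matrix n n ℂ)} (hE : IsEvenLimit Ψ E)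
    {x : Matrix n n ℂ} {μ : ℝ} (hx : Ψ x = (μ : ℂ) • x) (hμ : |μ| ≤ 1) :
    E x = if |μ| = 1 then x else 0 := by
  split_ifs with h1
  · refine hE.apply_of_fixed ?_
    rw [hx, map_smul, hx, smul_smul, ← Complex.ofReal_mul, ← abs_mul_abs_self, h1]
    simp
  -- `E x` is fixed by `Ψ ∘ Ψ` and is also scaled by `μ` under `Ψ`, so `μ² E x = E x`; here `μ² ≠
  -- 1`.
  · have h2 := hE.map_map x
    have h3 : Ψ (E x) = (μ : ℂ) • E x := by
      have := hE.pow_comm 1 x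
      rw [pow_one, hx, map_smul] at this
      exact this.symm
    rw [h3, map_smul, h3, smul_smul, ← Complex.ofReal_mul] at h2
    have h4 : ((μ * μ : ℝ) : ℂ) - 1 ≠ 0 := by
      have : μ * μ ≠ 1 := fun h => h1 (by
        rw [← abs_mul_abs_self] at h
        nlinarith [abs_nonneg μ])
      rw [sub_ne_zero]
      exact_mod_cast this
    have h5 : (((μ * μ : ℝ) : ℂ) - 1) • E x = 0 := by rw [sub_smul, one_smul, h2, sub_self]
    exact (smul_eq_zero.mp h5).resolve_left h4

/-- Removing the eigenvalues of modulus one leaves finitely many, all of modulus below one. This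
makes `λ` strictly positive. -/
theorem gnsOpNorm_lt_one {Ψ E : Module.End ℂ (Matrix n n ℂ)} {σ : Matrix n n ℂ}
    (h : IsSymmUnitalCP Ψ σ) (hσ : σ.PosDef) (hE : IsEvenLimit Ψ E) :
    gnsOpNorm σ (Ψ ∘ₗ (LinearMap.id - E)) < 1 := by
  obtain ⟨b, μ, hb, hΨ, hμ⟩ := h.exists_eigenbasis hσ
  let τ : Fin (Module.finrank ℂ (Matrix n n ℂ)) → ℝ := fun i => if |μ i| = 1 then 0 else μ i
  have hT : ∀ i, (Ψ ∘ₗ (LinearMap.id - E)) (b i) = (τ i : ℂ) • b i := fun i => by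
    simp only [LinearMap.comp_apply, LinearMap.sub_apply, LinearMap.id_apply,
      hE.apply_eigenvector (hΨ i) (hμ i), τ]
    split_ifs <;> simp [hΨ]
  have hτ : ∀ i, |τ i| < 1 := fun i => by
    simp only [τ]
    split_ifs with h1
    · simp
    · exact lt_of_le_of_ne (hμ i) h1
  let C : ℝ≥0 := Finset.univ.sup fun i => Real.nnabs (τ i)
  have hC : C < 1 := (Finset.sup_lt_iff (by simp)).mpr fun i _ => by
    rw [← NNReal.coe_lt_coe]
    simpa using hτ i
  refine (gnsOpNorm_le ((hb.forall_gnsNorm_le_iff hT C).mpr fun i => ?_)).trans_lt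
    (by exact_mod_cast hC)
  have := Finset.le_sup (f := fun i => Real.nnabs (τ i)) (Finset.mem_univ i)
  rw [← NNReal.coe_le_coe] at this
  simpa using this

end Spectral

/-! ### The limit under Hilbert-Schmidt duality -/

section Duality

variable {n : Type*} [Fintype n] [DecidableEq n]

theorem IsEvenLimit.hsAdjoint {Φ P : Module.End ℂ (Matrix n n ℂ)} (hP : IsEvenLimit Φ P) :
    IsEvenLimit (QuantumCapacity.hsAdjoint Φ) (QuantumCapacity.hsAdjoint P) := fun X => by
  simp only [← hsAdjoint_pow]
  refine tendsto_pi_nhds.mpr fun i => tendsto_pi_nhds.mpr fun j => ?_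
  exact ((by fun_prop : Continuous fun Y : Matrix n n ℂ => (Yᴴ * X).trace).tendsto _).comp
    (hP (Matrix.single i j 1))

theorem IsEvenLimit.isChannel {Φ P : Module.End ℂ (Matrix n n ℂ)} (hP : IsEvenLimit Φ P)
    (hΦ : IsChannel Φ) : IsChannel P := by
  refine ⟨fun k X hX => ?_, fun X => ?_⟩
  · refine posSemidef_of_tendsto (u := fun t : ℕ => ampliation k (Φ ^ (2 * t)) X) (l := atTop) ?_
      (Eventually.of_forall fun t => (hΦ.pow _).isCP k X hX)
    refine tendsto_pi_nhds.mpr fun a => tendsto_pi_nhds.mpr fun b => ?_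
    exact ((by fun_prop : Continuous fun Y : Matrix n n ℂ => Y a.2 b.2).tendsto _).comp (hP _)
  · refine tendsto_nhds_unique
      (((by fun_prop : Continuous fun Y : Matrix n n ℂ => Y.trace).tendsto _).comp (hP X))
      (tendsto_const_nhds.congr fun t => ?_)
    exact ((hΦ.pow _).tracePreserving X).symm

theorem hsAdjoint_smul_ofReal (c : ℝ) (Φ : Module.End ℂ (Matrix n n ℂ)) :
    hsAdjoint ((c : ℂ) • Φ) = (c : ℂ) • hsAdjoint Φ :=
  hsAdjoint_eq_of_forall fun X Y => by
    simp [trace_conjTranspose_mul_hsAdjoint]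

end Duality

/-! ### The order estimate for all ampliations -/

section Ampliation

variable {n : Type*} [Fintype n] [DecidableEq n] (k : ℕ)

/-- The `(a, c)` block of a block matrix. -/
def block {k : ℕ} (X : Matrix (Fin k × n) (Fin k × n) ℂ) (a c : Fin k) : Matrix n n ℂ :=
  Matrix.of fun i j => X (a, i) (c, j)

theorem block_ampliation {k : ℕ} (Φ : Module.End ℂ (Matrix n n ℂ))
    (X : Matrix (Fin k × n) (Fin k × n) ℂ) (a c : Fin k) :
    block (ampliation k Φ X) a c = Φ (block X a c) := rfl

open scoped Kronecker in
theorem trace_mul_one_kronecker (X Y : Matrix (Fin k × n) (Fin k × n) ℂ) (σ : Matrix n n ℂ) :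
    (X * Y * ((1 : Matrix (Fin k) (Fin k) ℂ) ⊗ₖ σ)).trace =
      ∑ a, ∑ c, (block X a c * block Y c a * σ).trace := by
  simp only [Matrix.trace, Matrix.diag, Fintype.sum_prod_type]
  refine Finset.sum_congr rfl fun a _ => ?_
  rw [Finset.sum_comm]
  refine Finset.sum_congr rfl fun i _ => ?_
  simp only [Matrix.mul_apply, Fintype.sum_prod_type, Matrix.kroneckerMap_apply, Matrix.one_apply,
    ite_mul, one_mul, zero_mul, mul_ite, mul_zero, Finset.sum_ite_irrel, Finset.sum_const_zero,
    Finset.sum_ite_eq', Finset.mem_univ, if_true]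
  rw [Finset.sum_comm]
  refine Finset.sum_congr rfl fun j _ => ?_
  rw [Finset.sum_mul]
  rfl

open scoped Kronecker in
theorem IsSymmUnitalCP.ampliation {Ψ : Module.End ℂ (Matrix n n ℂ)} {σ : Matrix n n ℂ}
    (h : IsSymmUnitalCP Ψ σ) :
    IsSymmUnitalCP (QuantumCapacity.ampliation k Ψ) ((1 : Matrix (Fin k) (Fin k) ℂ) ⊗ₖ σ) := by
  refine ⟨?_, ?_, fun X Y => ?_⟩
  · obtain ⟨L, hL⟩ := h.isCP.exists_krausMap
    rw [hL, ampliation_krausMap]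
    exact isCP_krausMap _
  · ext a c
    have hb : (Matrix.of fun i j => (1 : Matrix (Fin k × n) (Fin k × n) ℂ) (a.1, i) (c.1, j)) =
        (if a.1 = c.1 then (1 : ℂ) else 0) • (1 : Matrix n n ℂ) := by
      ext i j
      by_cases hac : a.1 = c.1 <;> simp [Matrix.one_apply, hac]
    rw [ampliation_apply, hb, map_smul, h.map_one]
    obtain ⟨a, i⟩ := a
    obtain ⟨c, j⟩ := c
    by_cases hac : a = c <;> simp [Matrix.one_apply, hac]
  · simp only [trace_mul_one_kronecker, block_ampliation, h.symm]

theorem IsEvenLimit.ampliation {Ψ E : Module.End ℂ (Matrix n n ℂ)} (hE : IsEvenLimit Ψ E) :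
    IsEvenLimit (QuantumCapacity.ampliation k Ψ) (QuantumCapacity.ampliation k E) := fun X => by
  simp only [← ampliation_pow]
  refine tendsto_pi_nhds.mpr fun a => tendsto_pi_nhds.mpr fun b => ?_
  exact ((by fun_prop : Continuous fun Y : Matrix n n ℂ => Y a.2 b.2).tendsto _).comp (hE _)

/-- The squared norm for the weight `1 ⊗ σ` is the sum of the squared norms of the blocks, so the
`L_2` bound survives ampliation with the same `q`. Only the index inequality has to be assumed
completely. -/
theorem isCP_pow_sub_smul {Ψ E : Module.End ℂ (Matrix n n ℂ)} {σ : Matrix n n ℂ}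
    (h : IsSymmUnitalCP Ψ σ) (hσ : σ.PosDef) (hE : IsEvenLimit Ψ E) {q Λ : ℝ} (hq : 0 < q)
    (hΛ : 0 < Λ) {t : ℕ}
    (hT : ∀ X, gnsNorm σ ((Ψ ^ t) (X - E X)) ≤ q * gnsNorm σ X)
    (hindex : IsCP ((Λ : ℂ) • E - 1)) : IsCP (Ψ ^ t - ((1 - Λ * q : ℝ) : ℂ) • (Ψ ^ t * E)) := by
  intro k X hX
  have key := posSemidef_pow_sub_smul (h.ampliation k) (Matrix.PosDef.one.kronecker hσ)
    (hE.ampliation k) hq hΛ (t := t) (fun Y => ?_) (fun Y hY => hindex k Y hY) hX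
  · rw [← ampliation_pow] at key
    exact key
  · rw [← ampliation_pow, trace_mul_one_kronecker, trace_mul_one_kronecker, Finset.mul_sum]
    refine Finset.sum_le_sum fun a _ => ?_
    rw [Finset.mul_sum]
    refine Finset.sum_le_sum fun c _ => ?_
    have h1 : ∀ Z : Matrix (Fin k × n) (Fin k × n) ℂ, block Zᴴ a c = (block Z c a)ᴴ :=
      fun Z => rfl
    have h2 : block (QuantumCapacity.ampliation k (Ψ ^ t) (Y - QuantumCapacity.ampliation k E Y))
        c a = (Ψ ^ t) (block Y c a - E (block Y c a)) := rfl
    rw [h1, h1, h2, trace_eq_gnsNorm_sq hσ, trace_eq_gnsNorm_sq hσ, ← Complex.ofReal_mul,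
      ← mul_pow]
    have h3 := pow_le_pow_left₀ (gnsNorm_nonneg σ _) (hT (block Y c a)) 2
    exact Complex.real_le_real.mpr h3

end Ampliation

/-! ### The threshold in `t` and equality of capacities -/

section MainComparison

variable {n : Type*} [Fintype n] [DecidableEq n]

/-- `E` commutes with `Ψ`, so powers of `Ψ` preserve `ker E`, where `Ψ` and `Ψ (id - E)` agree. The
first factor `Ψ (id - E)` lands in that kernel, and each of the `t` factors contributes `q`. -/
theorem gnsNorm_pow_sub_le {Ψ E : Module.End ℂ (Matrix n n ℂ)} {σ : Matrix n n ℂ}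
    (hE : IsEvenLimit Ψ E) {q : ℝ≥0} (hq : gnsOpNorm σ (Ψ ∘ₗ (LinearMap.id - E)) ≤ q) {t : ℕ}
    (ht : t ≠ 0) (X : Matrix n n ℂ) :
    gnsNorm σ ((Ψ ^ t) (X - E X)) ≤ (q : ℝ) ^ t * gnsNorm σ X := by
  have hstep : ∀ X, gnsNorm σ (Ψ (X - E X)) ≤ q * gnsNorm σ X :=
    fun X => gnsNorm_le_of_gnsOpNorm_le (T := Ψ ∘ₗ (LinearMap.id - E)) hq X
  have hker : ∀ (s : ℕ) (Y : Matrix n n ℂ), E Y = 0 →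
      gnsNorm σ ((Ψ ^ s) Y) ≤ (q : ℝ) ^ s * gnsNorm σ Y := fun s Y hY => by
    induction s with
    | zero => simp
    | succ s ih =>
      have h1 := hstep ((Ψ ^ s) Y)
      rw [hE.pow_comm, hY, map_zero, sub_zero] at h1
      rw [pow_succ', Module.End.mul_apply, pow_succ', mul_assoc]
      exact h1.trans (mul_le_mul_of_nonneg_left ih q.2)
  obtain ⟨s, rfl⟩ := Nat.exists_eq_succ_of_ne_zero ht
  have h0 : E (Ψ (X - E X)) = 0 := by
    have := hE.pow_comm 1 (X - E X)
    rw [pow_one] at this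
    rw [this, map_sub, hE.apply_apply, sub_self, map_zero]
  rw [Nat.succ_eq_add_one, pow_succ, Module.End.mul_apply, pow_succ, mul_assoc]
  exact (hker s _ h0).trans (mul_le_mul_of_nonneg_left (hstep X) (by positivity))

theorem mul_pow_lt_one_of_div_lt {L x : ℝ≥0∞} (hx0 : x ≠ 0) (hx1 : x < 1) {t : ℕ}
    (h : ENNReal.log L / -ENNReal.log x < (t : EReal)) : L * x ^ t < 1 := by
  have hpos : 0 < -ENNReal.log x := by
    rw [EReal.neg_pos]
    exact ENNReal.log_lt_zero_iff.mpr hx1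
  have htop : -ENNReal.log x ≠ ⊤ := by
    rw [Ne, EReal.neg_eq_top_iff]
    simpa using hx0
  rw [EReal.div_lt_iff hpos htop, mul_neg, ← ENNReal.log_pow, ← ENNReal.log_inv,
    ENNReal.log_lt_log_iff] at h
  have hxt0 : x ^ t ≠ 0 := pow_ne_zero t hx0
  have hxtt : x ^ t ≠ ⊤ := ENNReal.pow_ne_top (hx1.trans ENNReal.one_lt_top).ne
  calc L * x ^ t < (x ^ t)⁻¹ * x ^ t := (ENNReal.mul_lt_mul_iff_left hxt0 hxtt).mpr h
    _ = 1 := ENNReal.inv_mul_cancel hxt0 hxtt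

/-- For large `t` the channel `Φ ^ t` dominates a positive multiple of `P * Φ ^ t` in the
completely positive order. -/
theorem exists_isCP_pow_sub_smul [Nonempty n] {Φ P : Module.End ℂ (Matrix n n ℂ)}
    {σ : Matrix n n ℂ} (hΦ : IsChannel Φ) (hσ : σ.PosDef) (hsymm : IsGNSSymmetric Φ σ)
    (hP : IsEvenLimit Φ P) {t : ℕ}
    (ht : ENNReal.log (10 * completePimsnerPopa P) / contractionCoeff σ Φ P < (t : EReal)) :
    ∃ c : ℝ, 0 < c ∧ IsCP (Φ ^ t - (c : ℂ) • (P * Φ ^ t)) := by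
  have h := isSymmUnitalCP_hsAdjoint hΦ hsymm
  have hE := hP.hsAdjoint
  have hPc := hP.isChannel hΦ
  have hx1 := gnsOpNorm_lt_one h hσ hE
  suffices hs : ∃ c : ℝ, 0 < c ∧
      IsCP (hsAdjoint Φ ^ t - (c : ℂ) • (hsAdjoint Φ ^ t * hsAdjoint P)) by
    obtain ⟨c, hc, hcp⟩ := hs
    refine ⟨c, hc, ?_⟩
    have := isCP_hsAdjoint hcp
    rwa [hsAdjoint_sub, hsAdjoint_smul_ofReal, hsAdjoint_comp, hsAdjoint_pow, hsAdjoint_hsAdjoint,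
      hsAdjoint_hsAdjoint] at this
  unfold contractionCoeff at ht
  set x := gnsOpNorm σ (hsAdjoint Φ ∘ₗ (LinearMap.id - hsAdjoint P)) with hx
  rcases eq_or_ne x 0 with hx0 | hx0
  -- Here `λ = ⊤` and the quotient is `0`, so the hypothesis says `t ≥ 1`; then `Ψ ^ t = Ψ ^ t E`
  -- exactly and `c = 1` works.
  · rw [hx0, ENNReal.log_zero, EReal.neg_bot, EReal.div_top] at ht
    have ht0 : t ≠ 0 := by
      rintro rfl
      simp at ht
    refine ⟨1, one_pos, ?_⟩
    have h0 : hsAdjoint Φ ^ t - ((1 : ℝ) : ℂ) • (hsAdjoint Φ ^ t * hsAdjoint P) = 0 := by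
      ext1 X
      have h1 := gnsNorm_pow_sub_le hE (q := 0) (by rw [← hx, hx0]; simp) ht0 X
      rw [NNReal.coe_zero, zero_pow ht0, zero_mul] at h1
      have h2 := eq_zero_of_gnsNorm_eq_zero hσ (le_antisymm h1 (gnsNorm_nonneg _ _))
      rw [map_sub] at h2
      simpa using h2
    rw [h0]
    exact fun k X _ => Matrix.PosSemidef.zero
  · have hlt := mul_pow_lt_one_of_div_lt hx0 hx1 ht
    have hΛ1 := one_le_completePimsnerPopa hPc
    set Λ := completePimsnerPopa P with hΛ
    have hxt0 : x ^ t ≠ 0 := pow_ne_zero t hx0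
    -- With `x ≠ 0`, an infinite constant would make the threshold infinite, so the hypothesis on
    -- `t` itself provides finiteness.
    have hΛt : Λ ≠ ⊤ := by
      intro htop
      rw [htop, ENNReal.mul_top (by norm_num), ENNReal.top_mul hxt0] at hlt
      exact absurd hlt (by simp)
    have ht0 : t ≠ 0 := by
      rintro rfl
      rw [pow_zero, mul_one] at hlt
      exact absurd (hlt.trans_le (hΛ1.trans (le_mul_of_one_le_left' (by norm_num)))) (lt_irrefl _)
    obtain ⟨q, hq⟩ : ∃ q : ℝ≥0, (q : ℝ≥0∞) = x :=
      ⟨_, ENNReal.coe_toNNReal (hx1.trans ENNReal.one_lt_top).ne⟩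
    obtain ⟨C, hC⟩ : ∃ C : ℝ≥0, (C : ℝ≥0∞) = Λ := ⟨_, ENNReal.coe_toNNReal hΛt⟩
    have hq0 : (0 : ℝ) < q := by
      rw [← hq] at hx0
      exact_mod_cast pos_iff_ne_zero.mpr (by simpa using hx0)
    have hC1 : (1 : ℝ) ≤ C := by
      rw [← hC] at hΛ1
      exact_mod_cast hΛ1
    have hlt' : 10 * (C : ℝ) * (q : ℝ) ^ t < 1 := by
      rw [← hq, ← hC] at hlt
      exact_mod_cast hlt
    have hqt : (0 : ℝ) < (q : ℝ) ^ t := by positivity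
    have hindex := isCP_hsAdjoint (isCP_of_completePimsnerPopa_le (P := P) (C := C)
      (by rw [← hΛ, hC]))
    rw [hsAdjoint_sub, hsAdjoint_smul_ofReal, hsAdjoint_one] at hindex
    -- Positivity needs only `C q ^ t < 1`; the factor `10` leaves room.
    refine ⟨1 - C * (q : ℝ) ^ t, by nlinarith, ?_⟩
    exact isCP_pow_sub_smul h hσ hE hqt (by linarith)
      (gnsNorm_pow_sub_le hE (by rw [← hx, hq]) ht0) hindex

theorem capacities_pow_eq [Nonempty n] {Φ P : Module.End ℂ (Matrix n n ℂ)}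
    {σ : Matrix n n ℂ} (hΦ : IsChannel Φ) (hσ : σ.PosDef) (hsymm : IsGNSSymmetric Φ σ)
    (hP : IsEvenLimit Φ P) {t : ℕ}
    (ht : ENNReal.log (10 * completePimsnerPopa P) / contractionCoeff σ Φ P < (t : EReal)) :
    classicalCapacity 0 (Φ ^ t) = classicalCapacity 0 P ∧
      quantumCapacity 0 (Φ ^ t) = quantumCapacity 0 P := by
  obtain ⟨c, hc, hcp⟩ := exists_isCP_pow_sub_smul hΦ hσ hsymm hP ht
  have hPc := hP.isChannel hΦ
  have h1 : IsChannel (1 : Module.End ℂ (Matrix n n ℂ)) := hΦ.pow 0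
  -- The two factorizations are `P = Φ ^ t * Φ ^ t * P` and `P * Φ ^ t = 1 * P * Φ ^ t`.
  refine capacities_eq (hΦ.pow t) (hPc.comp (hΦ.pow t)) (hΦ.pow t) hPc h1 (hΦ.pow t) ?_
    (one_mul _).symm hc hcp
  ext1 X
  rw [← pow_add, ← two_mul]
  exact (hP.pow_two_mul_apply t X).symm

end MainComparison

/-! ### Tensor products of families of matrices -/

section TensorFamily

variable {m : Type*} [Fintype m] {n : ℕ}

/-- The tensor product `⨂ a, A a` of a family of matrices. -/
def tensorFamily (A : Fin n → Matrix m m ℂ) : Matrix (Fin n → m) (Fin n → m) ℂ :=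
  Matrix.of fun i j => ∏ a, A a (i a) (j a)

theorem tensorFamily_apply (A : Fin n → Matrix m m ℂ) (i j : Fin n → m) :
    tensorFamily A i j = ∏ a, A a (i a) (j a) := rfl

theorem prod_sum_eq_sum_prod {κ : Type*} [Fintype κ] (f : Fin n → κ → ℂ) :
    ∏ a, ∑ r, f a r = ∑ g : Fin n → κ, ∏ a, f a (g a) := by
  rw [Finset.prod_univ_sum, Fintype.piFinset_univ]

theorem tensorFamily_mul (A B : Fin n → Matrix m m ℂ) :
    tensorFamily A * tensorFamily B = tensorFamily fun a => A a * B a := by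
  ext i j
  simp only [Matrix.mul_apply, tensorFamily_apply, prod_sum_eq_sum_prod, Finset.prod_mul_distrib]

theorem tensorFamily_conjTranspose (A : Fin n → Matrix m m ℂ) :
    (tensorFamily A)ᴴ = tensorFamily fun a => (A a)ᴴ := by
  ext i j
  simp [tensorFamily_apply]

theorem trace_tensorFamily (A : Fin n → Matrix m m ℂ) :
    (tensorFamily A).trace = ∏ a, (A a).trace := by
  simp only [Matrix.trace, Matrix.diag, tensorFamily_apply, prod_sum_eq_sum_prod]

theorem tensorFamily_sum {κ : Type*} [Fintype κ] (B : Fin n → κ → Matrix m m ℂ) :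
    (tensorFamily fun a => ∑ r, B a r) = ∑ g : Fin n → κ, tensorFamily fun a => B a (g a) := by
  ext i j
  simp only [tensorFamily_apply, Matrix.sum_apply, prod_sum_eq_sum_prod]

theorem tensorFamily_smul (c : Fin n → ℂ) (A : Fin n → Matrix m m ℂ) :
    (tensorFamily fun a => c a • A a) = (∏ a, c a) • tensorFamily A := by
  ext i j
  simp only [tensorFamily_apply, Matrix.smul_apply, smul_eq_mul, Finset.prod_mul_distrib]

theorem tensorFamily_posSemidef {A : Fin n → Matrix m m ℂ} (hA : ∀ a, (A a).PosSemidef) :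
    (tensorFamily A).PosSemidef := by
  choose B hB using fun a => exists_eq_conjTranspose_mul_self (hA a)
  have : tensorFamily A = (tensorFamily B)ᴴ * tensorFamily B := by
    rw [tensorFamily_conjTranspose, tensorFamily_mul]
    exact congrArg tensorFamily (funext hB)
  rw [this]
  exact Matrix.posSemidef_conjTranspose_mul_self _

/-- Expand each factor as `A a = B a + (A a - B a)`: every term is a tensor product of positive
matrices, and subtraction removes the pure `B` term. -/
theorem tensorFamily_sub_posSemidef {A B : Fin n → Matrix m m ℂ} (hB : ∀ a, (B a).PosSemidef)
    (hAB : ∀ a, (A a - B a).PosSemidef) : (tensorFamily A - tensorFamily B).PosSemidef := by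
  classical
  have hA : A = fun a => ∑ r : Bool, if r then A a - B a else B a := by
    ext1 a
    simp
  have hsum : tensorFamily A - tensorFamily B =
      ∑ g ∈ Finset.univ.erase (fun _ : Fin n => false),
        tensorFamily fun a => if g a then A a - B a else B a := by
    conv_lhs => rw [hA, tensorFamily_sum]
    rw [← Finset.add_sum_erase _ _ (Finset.mem_univ fun _ : Fin n => false)]
    simp
  rw [hsum]
  refine Matrix.posSemidef_sum _ fun g _ => tensorFamily_posSemidef fun a => ?_
  split_ifs
  exacts [hAB a, hB a]

variable [DecidableEq m]

theorem tensorFamily_single (i j : Fin n → m) :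
    (tensorFamily fun a => Matrix.single (i a) (j a) (1 : ℂ)) = Matrix.single i j 1 := by
  ext k l
  simp only [tensorFamily_apply, Matrix.single_apply, Finset.prod_ite_zero, Finset.prod_const_one,
    Finset.mem_univ, true_imp_iff, forall_and, funext_iff]

theorem tensorFamily_one : (tensorFamily fun _ : Fin n => (1 : Matrix m m ℂ)) = 1 := by
  ext k l
  simp only [tensorFamily_apply, Matrix.one_apply, Finset.prod_ite_zero, Finset.prod_const_one,
    Finset.mem_univ, true_imp_iff, funext_iff]

theorem tensorFamily_posDef {σ : Matrix m m ℂ} (hσ : σ.PosDef) :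
    (tensorPowMatrix n σ).PosDef := by
  have hp : (tensorPowMatrix n σ).PosSemidef := tensorFamily_posSemidef fun _ => hσ.posSemidef
  refine hp.posDef_iff_isUnit.mpr ?_
  have hinv : tensorPowMatrix n σ * tensorFamily (fun _ => σ⁻¹) = 1 := by
    have hu : IsUnit σ.det := (Matrix.isUnit_iff_isUnit_det σ).mp hσ.isUnit
    change tensorFamily _ * _ = _
    rw [tensorFamily_mul, Matrix.mul_nonsing_inv σ hu, tensorFamily_one]
  exact IsUnit.of_mul_eq_one _ hinv

end TensorFamily

/-! ### Tensor powers of maps -/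

section TensorPow

variable {m : Type*} [Fintype m] [DecidableEq m] {n : ℕ}

theorem tensorPow_tensorFamily (Φ : Module.End ℂ (Matrix m m ℂ)) (A : Fin n → Matrix m m ℂ) :
    tensorPow n Φ (tensorFamily A) = tensorFamily fun a => Φ (A a) := by
  ext i j
  have h : ∀ a, Φ (A a) (i a) (j a) =
      ∑ k, ∑ l, A a k l * Φ (Matrix.single k l 1) (i a) (j a) := fun a => by
    conv_lhs => rw [linearMap_apply_eq_sum Φ (A a)]
    simp only [Matrix.sum_apply, Matrix.smul_apply, smul_eq_mul]
  simp only [tensorFamily_apply, h, prod_sum_eq_sum_prod]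
  simp only [tensorPow, LinearMap.coe_mk, AddHom.coe_mk, Matrix.of_apply, tensorFamily_apply,
    Finset.prod_mul_distrib]

theorem ext_tensorFamily {S T : Module.End ℂ (Matrix (Fin n → m) (Fin n → m) ℂ)}
    (h : ∀ A : Fin n → Matrix m m ℂ, S (tensorFamily A) = T (tensorFamily A)) : S = T :=
  ext_single fun i j => by rw [← tensorFamily_single, h]

theorem tensorPow_one : tensorPow n (1 : Module.End ℂ (Matrix m m ℂ)) = 1 :=
  ext_tensorFamily fun A => by rw [tensorPow_tensorFamily]; rfl

theorem tensorPow_mul (Φ Ψ : Module.End ℂ (Matrix m m ℂ)) :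
    tensorPow n (Φ * Ψ) = tensorPow n Φ * tensorPow n Ψ :=
  ext_tensorFamily fun A => by
    simp only [tensorPow_tensorFamily, Module.End.mul_apply]

theorem tensorPow_pow (Φ : Module.End ℂ (Matrix m m ℂ)) (t : ℕ) :
    tensorPow n (Φ ^ t) = tensorPow n Φ ^ t := by
  induction t with
  | zero => exact tensorPow_one
  | succ t ih => rw [pow_succ, pow_succ, tensorPow_mul, ih]

theorem tensorPow_krausMap {ι : Type*} [Fintype ι] (K : ι → Matrix m m ℂ) :
    tensorPow n (krausMap K) =
      krausMap fun g : Fin n → ι => tensorFamily fun a => K (g a) :=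
  ext_tensorFamily fun A => by
    simp only [tensorPow_tensorFamily, krausMap_apply, tensorFamily_sum, tensorFamily_mul,
      tensorFamily_conjTranspose]

theorem IsCP.tensorPow {Φ : Module.End ℂ (Matrix m m ℂ)} (hΦ : IsCP Φ) :
    IsCP (QuantumCapacity.tensorPow n Φ) := by
  obtain ⟨K, rfl⟩ := hΦ.exists_krausMap
  rw [tensorPow_krausMap]
  exact isCP_krausMap _

theorem hsAdjoint_tensorPow (Φ : Module.End ℂ (Matrix m m ℂ)) :
    hsAdjoint (tensorPow n Φ) = tensorPow n (hsAdjoint Φ) :=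
  ext_tensorFamily fun B => by
    ext i j
    rw [tensorPow_tensorFamily]
    change ((tensorPow n Φ (Matrix.single i j 1))ᴴ * tensorFamily B).trace = _
    rw [← tensorFamily_single, tensorPow_tensorFamily, tensorFamily_conjTranspose,
      tensorFamily_mul, trace_tensorFamily]
    rfl

theorem IsChannel.tensorPow {Φ : Module.End ℂ (Matrix m m ℂ)} (hΦ : IsChannel Φ) :
    IsChannel (QuantumCapacity.tensorPow n Φ) := by
  refine ⟨hΦ.isCP.tensorPow, fun X => ?_⟩
  have h := trace_conjTranspose_mul_hsAdjoint (QuantumCapacity.tensorPow n Φ) X 1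
  rw [hsAdjoint_tensorPow, ← tensorFamily_one, tensorPow_tensorFamily, hsAdjoint_map_one hΦ,
    tensorFamily_one, Matrix.mul_one, Matrix.mul_one, Matrix.trace_conjTranspose,
    Matrix.trace_conjTranspose] at h
  exact (star_injective h).symm

/-- This form is an identity of linear maps in `Y`, so for tensor powers it can be checked on
product matrices. -/
theorem isGNSSymmetric_iff {Φ : Module.End ℂ (Matrix m m ℂ)} (hΦ : IsCP Φ) (σ : Matrix m m ℂ) :
    IsGNSSymmetric Φ σ ↔ ∀ Y, hsAdjoint Φ Y * σ = Φ (Y * σ) := by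
  have key : ∀ X Y, (hsAdjoint Φ X * Y * σ).trace = (X * Φ (Y * σ)).trace := fun X Y => by
    rw [Matrix.mul_assoc, trace_hsAdjoint_mul hΦ]
  constructor
  · intro h Y
    refine eq_of_trace_conjTranspose_mul_eq fun X => ?_
    rw [← key, ← h, Matrix.mul_assoc]
  · intro h X Y
    rw [key, ← h, Matrix.mul_assoc]

theorem IsGNSSymmetric.tensorPow {Φ : Module.End ℂ (Matrix m m ℂ)} {σ : Matrix m m ℂ}
    (hΦ : IsCP Φ) (h : IsGNSSymmetric Φ σ) :
    IsGNSSymmetric (QuantumCapacity.tensorPow n Φ) (tensorPowMatrix n σ) := by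
  rw [isGNSSymmetric_iff hΦ] at h
  rw [isGNSSymmetric_iff hΦ.tensorPow]
  intro Y
  refine LinearMap.congr_fun (f := LinearMap.mulRight ℂ (tensorPowMatrix n σ) *
    hsAdjoint (QuantumCapacity.tensorPow n Φ)) (g := QuantumCapacity.tensorPow n Φ *
    LinearMap.mulRight ℂ (tensorPowMatrix n σ)) (ext_tensorFamily fun A => ?_) Y
  change hsAdjoint _ (tensorFamily A) * tensorFamily (fun _ => σ) =
    QuantumCapacity.tensorPow n Φ (tensorFamily A * tensorFamily fun _ => σ)
  rw [hsAdjoint_tensorPow, tensorPow_tensorFamily, tensorFamily_mul, tensorFamily_mul,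
    tensorPow_tensorFamily]
  simp only [h]

theorem IsEvenLimit.tensorPow {Φ P : Module.End ℂ (Matrix m m ℂ)} (hP : IsEvenLimit Φ P) :
    IsEvenLimit (QuantumCapacity.tensorPow n Φ) (QuantumCapacity.tensorPow n P) := fun X => by
  simp only [← tensorPow_pow]
  refine tendsto_pi_nhds.mpr fun i => tendsto_pi_nhds.mpr fun j => ?_
  refine tendsto_finsetSum _ fun k _ => tendsto_finsetSum _ fun l _ =>
    Tendsto.const_mul _ (tendsto_finsetProd _ fun a _ => ?_)
  exact ((by fun_prop : Continuous fun Y : Matrix m m ℂ => Y (i a) (j a)).tendsto _).comp (hP _)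

end TensorPow

/-! ### Invariance of the contraction coefficient under tensor powers -/

section TensorContraction

variable {m : Type*} [Fintype m] [DecidableEq m] {n : ℕ}

theorem IsGNSBasis.tensorFamily {κ : Type*} [Fintype κ] [DecidableEq κ] {σ : Matrix m m ℂ}
    {b : κ → Matrix m m ℂ} (hb : IsGNSBasis σ b) :
    IsGNSBasis (tensorPowMatrix n σ)
      fun g : Fin n → κ => QuantumCapacity.tensorFamily fun a => b (g a) := by
  refine ⟨fun f g => ?_, fun X => ?_⟩
  · change (_ * _ * QuantumCapacity.tensorFamily fun _ => σ).trace = _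
    rw [tensorFamily_conjTranspose, tensorFamily_mul, tensorFamily_mul, trace_tensorFamily]
    simp only [hb.orthonormal, Finset.prod_ite_zero, Finset.prod_const_one, Finset.mem_univ,
      true_imp_iff, funext_iff]
  · have hmem : X ∈ Submodule.span ℂ
        (Set.range fun g : Fin n → κ => QuantumCapacity.tensorFamily fun a => b (g a)) := by
      rw [Matrix.matrix_eq_sum_single X]
      refine Submodule.sum_mem _ fun i _ => Submodule.sum_mem _ fun j _ => ?_
      rw [← mul_one (X i j), ← smul_eq_mul, ← Matrix.smul_single, ← tensorFamily_single]
      refine Submodule.smul_mem _ _ ?_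
      choose c hc using fun a => hb.exists_eq_sum (Matrix.single (i a) (j a) 1)
      simp only [hc, tensorFamily_sum, tensorFamily_smul]
      exact Submodule.sum_mem _ fun g _ => Submodule.smul_mem _ _ (Submodule.subset_span ⟨g, rfl⟩)
    obtain ⟨c, hc⟩ := (Submodule.mem_span_range_iff_exists_fun ℂ).mp hmem
    exact ⟨c, hc.symm⟩

/-- In the product eigenbasis an eigenvalue survives only if some factor has modulus below one. The
other factors have modulus at most one, and choosing them of modulus one recovers every one-copy
value. -/
theorem gnsOpNorm_tensorPow [Nonempty m] {Ψ E : Module.End ℂ (Matrix m m ℂ)} {σ : Matrix m m ℂ}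
    (h : IsSymmUnitalCP Ψ σ) (hσ : σ.PosDef) (hE : IsEvenLimit Ψ E) (hn : 1 ≤ n) :
    gnsOpNorm (tensorPowMatrix n σ)
        (tensorPow n Ψ ∘ₗ (LinearMap.id - tensorPow n E)) =
      gnsOpNorm σ (Ψ ∘ₗ (LinearMap.id - E)) := by
  obtain ⟨b, μ, hb, hΨ, hμ⟩ := h.exists_eigenbasis hσ
  let e : Fin (Module.finrank ℂ (Matrix m m ℂ)) → ℝ := fun i => if |μ i| = 1 then 1 else 0
  have hEb : ∀ i, E (b i) = (e i : ℂ) • b i := fun i => by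
    simp only [hE.apply_eigenvector (hΨ i) (hμ i), e]
    split_ifs <;> simp
  have hT : ∀ i, (Ψ ∘ₗ (LinearMap.id - E)) (b i) = ((μ i * (1 - e i) : ℝ) : ℂ) • b i := fun i => by
    simp only [LinearMap.comp_apply, LinearMap.sub_apply, LinearMap.id_apply, hEb, map_sub,
      map_smul, hΨ]
    push_cast
    module
  have hTn : ∀ g : Fin n → Fin (Module.finrank ℂ (Matrix m m ℂ)),
      (tensorPow n Ψ ∘ₗ (LinearMap.id - tensorPow n E)) (tensorFamily fun a => b (g a)) =
        (((∏ a, μ (g a)) * (1 - ∏ a, e (g a)) : ℝ) : ℂ) • tensorFamily fun a => b (g a) :=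
    fun g => by
      simp only [LinearMap.comp_apply, LinearMap.sub_apply, LinearMap.id_apply,
        tensorPow_tensorFamily, hEb, map_sub, tensorFamily_smul, map_smul, hΨ]
      push_cast
      module
  -- Otherwise `E` would vanish on the whole basis, contradicting `E 1 = 1`.
  obtain ⟨i₁, hi₁⟩ : ∃ i, |μ i| = 1 := by
    by_contra! hne
    have h1 := hE.apply_one h
    rw [hb.eq_sum 1] at h1
    simp only [map_sum, map_smul, hEb, e, hne, if_false, Complex.ofReal_zero, zero_smul, smul_zero,
      Finset.sum_const_zero] at h1
    rw [← hb.eq_sum] at h1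
    exact zero_ne_one h1
  have hiff : ∀ C : ℝ≥0, (∀ g : Fin n → Fin (Module.finrank ℂ (Matrix m m ℂ)),
      |(∏ a, μ (g a)) * (1 - ∏ a, e (g a))| ≤ C) ↔ ∀ i, |μ i * (1 - e i)| ≤ C := fun C => by
    constructor
    · intro hg i
      by_cases hi : |μ i| = 1
      · simp [e, hi]
      let a₀ : Fin n := ⟨0, hn⟩
      have h1 := hg (Function.update (fun _ => i₁) a₀ i)
      have he : ∏ a, e (Function.update (fun _ => i₁) a₀ i a) = 0 :=
        Finset.prod_eq_zero (Finset.mem_univ a₀) (by simp [e, hi])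
      have hm : |∏ a, μ (Function.update (fun _ => i₁) a₀ i a)| = |μ i| := by
        rw [Finset.abs_prod, Finset.prod_eq_single a₀]
        · simp
        · intro a _ ha
          rw [Function.update_of_ne ha, hi₁]
        · simp
      rw [he, sub_zero, mul_one, hm] at h1
      simpa [e, hi] using h1
    · intro hi g
      by_cases hall : ∀ a, |μ (g a)| = 1
      · simp [e, hall]
      push Not at hall
      obtain ⟨a₀, ha₀⟩ := hall
      have he : ∏ a, e (g a) = 0 :=
        Finset.prod_eq_zero (Finset.mem_univ a₀) (by simp [e, ha₀])
      have h1 := hi (g a₀)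
      simp only [e, ha₀, if_false, sub_zero, mul_one] at h1
      rw [he, sub_zero, mul_one, Finset.abs_prod]
      refine le_trans ?_ h1
      rw [← Finset.mul_prod_erase _ _ (Finset.mem_univ a₀)]
      exact mul_le_of_le_one_right (abs_nonneg _)
        (Finset.prod_le_one (fun a _ => abs_nonneg _) fun a _ => hμ (g a))
  simp only [gnsOpNorm, hb.forall_gnsNorm_le_iff hT, (hb.tensorFamily (n := n)).forall_gnsNorm_le_iff
    hTn, hiff]

theorem contractionCoeff_tensorPow [Nonempty m] {Φ P : Module.End ℂ (Matrix m m ℂ)}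
    {σ : Matrix m m ℂ} (hΦ : IsChannel Φ) (hσ : σ.PosDef) (hsymm : IsGNSSymmetric Φ σ)
    (hP : IsEvenLimit Φ P) (hn : 1 ≤ n) :
    contractionCoeff (tensorPowMatrix n σ) (tensorPow n Φ) (tensorPow n P) =
      contractionCoeff σ Φ P := by
  rw [contractionCoeff, contractionCoeff, hsAdjoint_tensorPow, hsAdjoint_tensorPow,
    gnsOpNorm_tensorPow (isSymmUnitalCP_hsAdjoint hΦ hsymm) hσ hP.hsAdjoint hn]

end TensorContraction

/-! ### Multiplicativity of the complete Pimsner-Popa constant -/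

section TensorPimsnerPopa

variable {m : Type*} [Fintype m] [DecidableEq m] {n : ℕ}

theorem choi_tensorPow (Φ : Module.End ℂ (Matrix m m ℂ)) :
    choi (tensorPow n Φ) = (tensorFamily fun _ : Fin n => choi Φ).submatrix
      (fun p a => (p.1 a, p.2 a)) fun p a => (p.1 a, p.2 a) := by
  ext p q
  simp only [choi, Matrix.of_apply, Matrix.submatrix_apply, tensorFamily_apply]
  rw [← tensorFamily_single, tensorPow_tensorFamily]
  rfl

theorem choi_smul_sub_one (c : ℂ) (Φ : Module.End ℂ (Matrix m m ℂ)) :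
    choi (c • Φ - 1) = c • choi Φ - choi (1 : Module.End ℂ (Matrix m m ℂ)) := rfl

theorem isCP_tensorPow_sub_one_iff (c : ℂ) (P : Module.End ℂ (Matrix m m ℂ)) :
    IsCP (c • tensorPow n P - 1) ↔ (c • (tensorFamily fun _ : Fin n => choi P) -
      tensorFamily fun _ : Fin n => choi (1 : Module.End ℂ (Matrix m m ℂ))).PosSemidef := by
  rw [isCP_iff_choi_posSemidef, choi_smul_sub_one, ← tensorPow_one, choi_tensorPow,
    choi_tensorPow, ← Matrix.posSemidef_submatrix_equiv
      (Equiv.arrowProdEquivProdArrow (Fin n) (fun _ => m) fun _ => m).symm]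
  rfl

/-- Testing on the product vector `v^{⊗n}` turns the hypothesis into an inequality between `n`-th
powers of nonnegative reals, from which roots can be taken. -/
theorem smul_sub_posSemidef_of_tensorFamily {k : Type*} [Fintype k] {A B : Matrix k k ℂ}
    (hA : A.PosSemidef) (hB : B.PosSemidef) (hn : n ≠ 0) {c : ℝ} (hc : 0 ≤ c)
    (h : (((c ^ n : ℝ) : ℂ) • (tensorFamily fun _ : Fin n => A) -
      tensorFamily fun _ : Fin n => B).PosSemidef) : ((c : ℂ) • A - B).PosSemidef := by
  refine Matrix.posSemidef_iff_dotProduct_mulVec.mpr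
    ⟨(posSemidef_smul hA hc).1.sub hB.1, fun v => ?_⟩
  rw [← trace_mul_vecMulVec]
  set W := Matrix.vecMulVec v (star v) with hW
  have hWp : W.PosSemidef := Matrix.posSemidef_vecMulVec_self_star v
  have h1 := trace_mul_nonneg h (tensorFamily_posSemidef fun _ : Fin n => hWp)
  rw [Matrix.sub_mul, Matrix.smul_mul, tensorFamily_mul, tensorFamily_mul, Matrix.trace_sub,
    Matrix.trace_smul, trace_tensorFamily, trace_tensorFamily, Finset.prod_const,
    Finset.prod_const, Finset.card_univ, Fintype.card_fin, smul_eq_mul, sub_nonneg] at h1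
  rw [Matrix.sub_mul, Matrix.smul_mul, Matrix.trace_sub, Matrix.trace_smul, smul_eq_mul,
    sub_nonneg]
  obtain ⟨x, hx0, hx⟩ := exists_ofReal_eq_trace_mul hA hWp
  obtain ⟨y, hy0, hy⟩ := exists_ofReal_eq_trace_mul hB hWp
  rw [← hx, ← hy] at h1 ⊢
  have h2 : y ^ n ≤ (c * x) ^ n := by
    rw [mul_pow]
    exact_mod_cast h1
  exact_mod_cast (pow_le_pow_iff_left₀ hy0 (mul_nonneg hc hx0) hn).mp h2

theorem completePimsnerPopa_tensorPow [Nonempty m] {P : Module.End ℂ (Matrix m m ℂ)}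
    (hP : IsChannel P) (hn : 1 ≤ n) :
    completePimsnerPopa (tensorPow n P) = completePimsnerPopa P ^ n := by
  have hn0 : n ≠ 0 := Nat.one_le_iff_ne_zero.mp hn
  have hone : IsCP (1 : Module.End ℂ (Matrix m m ℂ)) := (hP.pow 0).isCP
  apply le_antisymm
  · rcases eq_or_ne (completePimsnerPopa P) ⊤ with htop | htop
    · rw [htop, ENNReal.top_pow hn0]
      exact le_top
    obtain ⟨C, hC⟩ : ∃ C : ℝ≥0, (C : ℝ≥0∞) = completePimsnerPopa P :=
      ⟨_, ENNReal.coe_toNNReal htop⟩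
    have hcp := isCP_of_completePimsnerPopa_le hC.ge
    have hC1 : 0 < C := zero_lt_one.trans_le (one_le_of_isCP hP hcp)
    rw [← hC, ← ENNReal.coe_pow]
    refine completePimsnerPopa_le (by positivity) ?_
    rw [isCP_tensorPow_sub_one_iff]
    have h1 := tensorFamily_sub_posSemidef (n := n)
      (A := fun _ => ((C : ℝ) : ℂ) • choi P) (fun _ => hone.choi_posSemidef)
      fun _ => hcp.choi_posSemidef
    rw [tensorFamily_smul, Finset.prod_const, Finset.card_univ, Fintype.card_fin] at h1
    simpa using h1
  · rcases eq_or_ne (completePimsnerPopa (tensorPow n P)) ⊤ with htop | htop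
    · rw [htop]
      exact le_top
    obtain ⟨D, hD⟩ : ∃ D : ℝ≥0, (D : ℝ≥0∞) = completePimsnerPopa (tensorPow n P) :=
      ⟨_, ENNReal.coe_toNNReal htop⟩
    have hcp := isCP_of_completePimsnerPopa_le hD.ge
    have hD1 : 0 < D := zero_lt_one.trans_le (one_le_of_isCP hP.tensorPow hcp)
    -- The `n`-th root of a constant admissible for the tensor power is admissible for one copy.
    set c : ℝ≥0 := D ^ ((n : ℝ)⁻¹) with hc
    have hcn : c ^ n = D := NNReal.rpow_inv_natCast_pow D hn0
    have hc0 : 0 < c := NNReal.rpow_pos hD1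
    rw [isCP_tensorPow_sub_one_iff, ← hcn, NNReal.coe_pow] at hcp
    have h1 := smul_sub_posSemidef_of_tensorFamily hP.isCP.choi_posSemidef hone.choi_posSemidef
      hn0 c.2 hcp
    rw [← hD, ← hcn, ENNReal.coe_pow]
    exact pow_le_pow_left₀ zero_le
      (completePimsnerPopa_le hc0 (isCP_iff_choi_posSemidef.mpr h1)) n

end TensorPimsnerPopa

end

end QuantumCapacity

/-! ### The main theorem -/

theorem mainTheorem3 {m : Type*} [Fintype m] [DecidableEq m]
    (Φ : Module.End ℂ (Matrix m m ℂ)) (σ : Matrix m m ℂ)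
    (hΦ : QuantumCapacity.IsChannel Φ)
    (hσ : σ.PosDef) (hσ_trace : σ.trace = 1)
    (hsymm : QuantumCapacity.IsGNSSymmetric Φ σ) :
    ∃ P : Module.End ℂ (Matrix m m ℂ),
      QuantumCapacity.IsChannel P ∧
      (∀ X, Tendsto (fun t : ℕ => (Φ ^ (2 * t)) X) atTop (𝓝 (P X))) ∧
      (∀ t : ℕ,
        ENNReal.log (10 * QuantumCapacity.completePimsnerPopa P) /
            QuantumCapacity.contractionCoeff σ Φ P < (t : EReal) →
          QuantumCapacity.classicalCapacity 0 (Φ ^ t) = QuantumCapacity.classicalCapacity 0 P ∧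
          QuantumCapacity.quantumCapacity 0 (Φ ^ t) = QuantumCapacity.quantumCapacity 0 P) ∧
      (∀ n : ℕ, 1 ≤ n →
        (∀ X, Tendsto (fun t : ℕ => (QuantumCapacity.tensorPow n Φ ^ (2 * t)) X) atTop
          (𝓝 (QuantumCapacity.tensorPow n P X))) ∧
        QuantumCapacity.contractionCoeff (QuantumCapacity.tensorPowMatrix n σ)
            (QuantumCapacity.tensorPow n Φ) (QuantumCapacity.tensorPow n P) =
          QuantumCapacity.contractionCoeff σ Φ P ∧
        QuantumCapacity.completePimsnerPopa (QuantumCapacity.tensorPow n P) =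
          QuantumCapacity.completePimsnerPopa P ^ n ∧
        ∀ t : ℕ,
          ((n : EReal) * ENNReal.log (QuantumCapacity.completePimsnerPopa P) + ENNReal.log 10) /
              QuantumCapacity.contractionCoeff σ Φ P < (t : EReal) →
            QuantumCapacity.classicalCapacity 0 (QuantumCapacity.tensorPow n Φ ^ t) =
              QuantumCapacity.classicalCapacity 0 (QuantumCapacity.tensorPow n P) ∧
            QuantumCapacity.quantumCapacity 0 (QuantumCapacity.tensorPow n Φ ^ t) =
              QuantumCapacity.quantumCapacity 0 (QuantumCapacity.tensorPow n P)) := by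
  open QuantumCapacity in
  have hm : Nonempty m := by
    by_contra hempty
    rw [not_nonempty_iff] at hempty
    simp [Matrix.trace] at hσ_trace
  have h := isSymmUnitalCP_hsAdjoint hΦ hsymm
  obtain ⟨b, μ, hb, hΨ, hμ⟩ := h.exists_eigenbasis hσ
  obtain ⟨E, hE⟩ := exists_isEvenLimit hb hΨ hμ
  -- `E` is the limit of even powers of `Φ^*`, so the limit for `Φ` is its adjoint.
  have hP : IsEvenLimit Φ (hsAdjoint E) := by
    have := hE.hsAdjoint
    rwa [hsAdjoint_hsAdjoint] at this
  refine ⟨hsAdjoint E, hP.isChannel hΦ, hP, fun t => capacities_pow_eq hΦ hσ hsymm hP,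
    fun n hn => ?_⟩
  have hcoeff := contractionCoeff_tensorPow hΦ hσ hsymm hP hn
  have hΛ := completePimsnerPopa_tensorPow (hP.isChannel hΦ) hn
  refine ⟨hP.tensorPow, hcoeff, hΛ, fun t ht => ?_⟩
  refine capacities_pow_eq hΦ.tensorPow (tensorFamily_posDef hσ)
    (hsymm.tensorPow hΦ.isCP) hP.tensorPow ?_
  -- Since `λ` does not change and `Λ_c` becomes its `n`-th power, the one-copy threshold splits as
  -- `n log Λ_c + log 10`.
  rw [hcoeff, hΛ, ENNReal.log_mul_add, ENNReal.log_pow, add_comm]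
  exact ht
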